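/- **Theorem (Matrix Laplace transform of Poisson shot noise).** Let $\Phi=\sum_{k<N}\delta_{X_k}$ ($N\in\{0,1,\dots\}\cup\{\infty\}$) be a Poisson point process on $\mathbb{R}^d$ with locally finite intensity measure $\Lambda$. Let $(H(x))_{x\in\mathbb{R}^d}$ be $[0,\infty)$-valued random variables such that the law of $H(x)$ depends ($\Lambda$-almost everywhere) measurably on $x$. Let $\Phi$ be independently marked by $H$: conditionally on the points $(X_k)_{k<N}$, the marks $H(X_k)$, $k<N$, are independent, and the mark of the point $X_k$ has the law of $H(x)$ at $x=X_k$. Let $$I=\sum_{k<N}H(X_k)\in[0,\infty]$$ be the shot noise. For a random variable $Y\in[0,\infty]$ and $\mathbf S\in\mathbb{C}^{n\times n}$, $n\ge 1$, the matrix Laplace transform is $\boldsymbol{\mathcal L}_Y(\mathbf S)=\mathbb{E}[\exp(-\mathbf S Y)]$ (entrywise expectation), where $\exp(-\infty\,\mathbf S)=\lim_{t\to\infty}\exp(-t\mathbf S)$. It exists if $\exp(-\mathbf SY)$ is a.s. well defined (that is, a.s. either $Y<\infty$ or this limit exists) and has integrable entries. Write $\boldsymbol{\mathcal L}_H(\mathbf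 S;x)$ for the matrix Laplace transform of $H(x)$ and $\mathcal L_H(s;x)=\mathbb{E}[e^{-sH(x)}]$, $s\in\mathbb{C}$. A Jordan block has its eigenvalue on the diagonal, ones on the first upper off-diagonal, and zeros elsewhere. We say that *the formula holds at* $\mathbf S$ if $\boldsymbol{\mathcal L}_I(\mathbf S)$ exists, $\boldsymbol{\mathcal L}_H(\mathbf S;x)$ exists for $\Lambda$-almost every $x$, the entries of $\mathbf I-\boldsymbol{\mathcal L}_H(\mathbf S;x)$ are $\Lambda$-integrable, and $$\boldsymbol{\mathcal L}_I(\mathbf S)=\exp\Big(-\int_{\mathbb{R}^d}\big(\mathbf I-\boldsymbol{\mathcal L}_H(\mathbf S;x)\big)\,\Lambda(dx)\Big).$$ (i) Let $\mathbf J\in\mathbb{C}^{n\times n}$ be a Jordan block with eigenvalue $\lambda$, $\Re\lambda>0$. If $\int_{\mathbb{R}^d}(1-\mathcal L_H(\lambda;x))\,\Lambda(dx)$ converges (i.e. the integrand is $\Lambda$-integrable), the formula holds at $\mathbf J$. Otherwise $\boldsymbol{\mathcal L}_I(\mathbf J)$ exists and is the zero matrix. (ii) Let $n\ge 2$ and let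 $\mathbf J_0$ be the $n\times n$ Jordan block with eigenvalue $0$. If $\int_{\mathbb{R}^d}\mathbb{E}[H(x)^{n-1}]\,\Lambda(dx)<\infty$ and, in case $n\ge 3$, also $\int_{\mathbb{R}^d}(1-\mathcal L_H(s;x))\,\Lambda(dx)$ converges for all real $s\ge 0$, then the formula holds at $\mathbf J_0$. Otherwise (that is, if either condition fails) $\boldsymbol{\mathcal L}_I(\mathbf J_0)$ does not exist. (iii) Let $\mathbf J\in\mathbb{C}^{n\times n}$ be a Jordan block with eigenvalue $\lambda$, $\Re\lambda=0$. If $\int_{\mathbb{R}^d}(1-\mathcal L_H(s;x))\,\Lambda(dx)$ converges for all real $s\ge 0$ and $\int_{\mathbb{R}^d}\mathbb{E}[H(x)^{n-1}]\,\Lambda(dx)<\infty$ (with $0^0=1$), the formula holds at $\mathbf J$. -/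

import Mathlib

open MeasureTheory ProbabilityTheory Filter Topology
open scoped ENNReal NNReal

noncomputable section

namespace ShotNoise

/-- The `n × n` Jordan block with eigenvalue `lam`: `lam` on the diagonal, ones on the first
upper off-diagonal, zeros elsewhere. -/
def jordanBlock (n : ℕ) (lam : ℂ) : Matrix (Fin n) (Fin n) ℂ :=
  Matrix.of fun i j => if i = j then lam else if (i : ℕ) + 1 = (j : ℕ) then 1 else 0

section Laplace

variable {Ω : Type*} [MeasurableSpace Ω] {n : ℕ}

/-- The matrix `exp (-t S)` for `t ∈ [0, ∞]`, where `exp (-∞ S)` is the limit of `exp (-r S)`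
as `r → ∞` (a meaningful value only if that limit exists, see `MatrixLaplaceExists`). -/
def expNegMul (S : Matrix (Fin n) (Fin n) ℂ) (t : ℝ≥0∞) : Matrix (Fin n) (Fin n) ℂ :=
  if t = ∞ then limUnder atTop (fun r : ℝ => NormedSpace.exp (-((r : ℂ) • S)))
  else NormedSpace.exp (-((t.toReal : ℂ) • S))

/-- The matrix Laplace transform `E[exp (-S X)]` of a `[0, ∞]`-valued random variable `X`
exists: `exp (-S X)` is almost surely well defined, and all its entries are integrable. -/
def MatrixLaplaceExists (P : Measure Ω) (X : Ω → ℝ≥0∞) (S : Matrix (Fin n) (Fin n) ℂ) : Prop :=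
  (∀ᵐ ω ∂P, X ω = ∞ → ∃ L : Matrix (Fin n) (Fin n) ℂ,
    Tendsto (fun r : ℝ => NormedSpace.exp (-((r : ℂ) • S))) atTop (𝓝 L)) ∧
  ∀ i j, Integrable (fun ω => expNegMul S (X ω) i j) P

/-- The matrix Laplace transform `E[exp (-S X)]`, the expectation being taken entrywise. -/
def matrixLaplace (P : Measure Ω) (X : Ω → ℝ≥0∞) (S : Matrix (Fin n) (Fin n) ℂ) :
    Matrix (Fin n) (Fin n) ℂ :=
  Matrix.of fun i j => ∫ ω, expNegMul S (X ω) i j ∂P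

/-- The scalar Laplace transform `E[exp (-s X)]` of a nonnegative random variable. -/
def scalarLaplace (P : Measure Ω) (X : Ω → ℝ≥0) (s : ℂ) : ℂ :=
  ∫ ω, Complex.exp (-(s * ((X ω : ℝ) : ℂ))) ∂P

end Laplace

section PointProcess

variable {Ω : Type*} [MeasurableSpace Ω] {d : ℕ}

/-- The counting measure `∑_{k < N} δ_{x k}`, with `N ∈ ℕ ∪ {∞}`. -/
def countingMeasure (N : ℕ∞) (x : ℕ → EuclideanSpace ℝ (Fin d)) :
    Measure (EuclideanSpace ℝ (Fin d)) :=
  Measure.sum fun k : ℕ => if (k : ℕ∞) < N then Measure.dirac (x k) else 0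

/-- `Φ` is a Poisson point process on `ℝ^d` with intensity measure `Λ`: a random measure such
that `Φ(B)` is Poisson distributed with mean `Λ(B)` whenever `Λ(B) < ∞`, and such that the counts
of finitely many pairwise disjoint Borel sets are independent. -/
structure IsPoissonPointProcess (P : Measure Ω) (Φ : Ω → Measure (EuclideanSpace ℝ (Fin d)))
    (Λ : Measure (EuclideanSpace ℝ (Fin d))) : Prop where
  measurable : Measurable Φ
  map_apply : ∀ B : Set (EuclideanSpace ℝ (Fin d)), MeasurableSet B → Λ B < ∞ →
    P.map (fun ω => Φ ω B) = (poissonMeasure (Λ B).toNNReal).map (fun k : ℕ => (k : ℝ≥0∞))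
  indep : ∀ (m : ℕ) (B : Fin m → Set (EuclideanSpace ℝ (Fin d))), (∀ i, MeasurableSet (B i)) →
    Pairwise (fun i j => Disjoint (B i) (B j)) → iIndepFun (fun i ω => Φ ω (B i)) P

/-- `X 0, X 1, …, X (N - 1)` is a measurable enumeration of the points of `Φ`, counted with
multiplicity; the values `X k` with `k ≥ N` are irrelevant. -/
structure IsEnumeration (P : Measure Ω) (Φ : Ω → Measure (EuclideanSpace ℝ (Fin d)))
    (N : Ω → ℕ∞) (X : ℕ → Ω → EuclideanSpace ℝ (Fin d)) : Prop where
  measurable_card : Measurable N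
  measurable_point : ∀ k, Measurable (X k)
  eq_countingMeasure : ∀ᵐ ω ∂P, Φ ω = countingMeasure (N ω) (fun k => X k ω)

/-- The number of points together with the points `X 0, …, X (N - 1)`, padded with zeros. -/
def points (N : Ω → ℕ∞) (X : ℕ → Ω → EuclideanSpace ℝ (Fin d)) (ω : Ω) :
    ℕ∞ × (ℕ → EuclideanSpace ℝ (Fin d)) :=
  (N ω, fun k => if (k : ℕ∞) < N ω then X k ω else 0)

/-- Independent marking: conditionally on the points, the marks `M 0, …, M (N - 1)` are
independent, and the mark `M k` of the point `X k` has the law `law (X k)`. -/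
structure IsIndependentMarking (P : Measure Ω) (N : Ω → ℕ∞)
    (X : ℕ → Ω → EuclideanSpace ℝ (Fin d)) (M : ℕ → Ω → ℝ≥0)
    (law : EuclideanSpace ℝ (Fin d) → Measure ℝ≥0) : Prop where
  measurable_mark : ∀ k, Measurable (M k)
  measure_inter : ∀ (m : ℕ) (A : Set (ℕ∞ × (ℕ → EuclideanSpace ℝ (Fin d)))) (U : Fin m → Set ℝ≥0),
    MeasurableSet A → (∀ i, MeasurableSet (U i)) →
    P {ω | (m : ℕ∞) ≤ N ω ∧ points N X ω ∈ A ∧ ∀ i : Fin m, M i ω ∈ U i} =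
      ∫⁻ ω in {ω | (m : ℕ∞) ≤ N ω ∧ points N X ω ∈ A}, ∏ i : Fin m, law (X i ω) (U i) ∂P

/-- The shot noise `∑_{k < N} M k`, with values in `[0, ∞]`. -/
def shotNoise (N : Ω → ℕ∞) (M : ℕ → Ω → ℝ≥0) (ω : Ω) : ℝ≥0∞ :=
  ∑' k : ℕ, if (k : ℕ∞) < N ω then (M k ω : ℝ≥0∞) else 0

/-- The formula `𝓛_I(S) = exp (-∫ (1 - 𝓛_H(S; x)) Λ(dx))`, including the existence of the
transform of `I`, of the transform of `H x` for `Λ`-almost every `x`, and of the integral. -/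
def CampbellFormula {Ω' : Type*} [MeasurableSpace Ω'] {n : ℕ} (P : Measure Ω) (I : Ω → ℝ≥0∞)
    (P' : Measure Ω') (H : EuclideanSpace ℝ (Fin d) → Ω' → ℝ≥0)
    (Λ : Measure (EuclideanSpace ℝ (Fin d))) (S : Matrix (Fin n) (Fin n) ℂ) : Prop :=
  MatrixLaplaceExists P I S ∧
  (∀ᵐ x ∂Λ, MatrixLaplaceExists P' (fun ω' => (H x ω' : ℝ≥0∞)) S) ∧
  (∀ i j, Integrable (fun x => (1 - matrixLaplace P' (fun ω' => (H x ω' : ℝ≥0∞)) S) i j) Λ) ∧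
  matrixLaplace P I S =
    NormedSpace.exp (-(Matrix.of fun i j =>
      ∫ x, (1 - matrixLaplace P' (fun ω' => (H x ω' : ℝ≥0∞)) S) i j ∂Λ))

end PointProcess

end ShotNoise

end

/-! Let ν = `Λ.bind κ` be the intensity of the marks, where κ is a Markov kernel that agrees Λ-a.e.
with the law of H(x), and let ψ(z) = ∫ (1 - exp(-zh)) ν(dh). Averaging the marks and applying the
Laplace functional of the Poisson process gives E exp(-sI) = exp(-ψ(s)) for all s in [0, ∞]
(`lintegral_expNeg_shotNoise`). From then on only this identity, `HasLevyLaplace`, is used.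

The exponential exp(-tJ) of a Jordan block with eigenvalue z is upper triangular Toeplitz with
coefficients (-t)^k exp(-zt)/k!. Hence the entries of the matrix transform are φ^(k)(z)/k! for the
scalar transform φ of I. Upper triangular Toeplitz matrices multiply like truncated power series, so
the formula says that the Taylor coefficients of φ are those of exp(-ψ). Both are determined by
their term of order zero and the recursion from φ' = -ψ'φ (`exp_toeplitz`,
`HasLevyLaplace.expMoment_succ`).

Finiteness of ψ at one point of the open right half-plane is equivalent to ∫ min(1, h) dν < ∞. If
this fails, I = ∞ a.s. and exp(-∞J) = 0 for Re z > 0. If it holds, I < ∞ a.s., the identity φ =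
exp(-ψ) extends analytically from the positive axis to Re z > 0, and the Leibniz rule gives the
recursion there.

On Re z = 0 the recursion is a limit from the right, by dominated convergence. This needs moments up
to order n - 1. With signs removed, the recursion at real a > 0 has only nonnegative terms: it
bounds the moments of I by those of ν, and its term with i = 0 bounds a moment of ν by the same
moment of I. The second bound gives the converse at eigenvalue 0, where existence of the transform
forces I < ∞ a.s. and E I^(n-1) < ∞. -/

namespace ShotNoise

/-! ### Upper triangular Toeplitz matrices as truncated power series -/

section Toeplitz

/-- The upper triangular Toeplitz matrix with entry `f (j - i)` at `(i, j)`, `i ≤ j`. -/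
def toeplitz (n : ℕ) (f : ℕ → ℂ) : Matrix (Fin n) (Fin n) ℂ :=
  Matrix.of fun i j => if i ≤ j then f ((j : ℕ) - (i : ℕ)) else 0

lemma toeplitz_apply_le {n : ℕ} (f : ℕ → ℂ) {i j : Fin n} (h : i ≤ j) :
    toeplitz n f i j = f ((j : ℕ) - (i : ℕ)) := by
  simp [toeplitz, h]

lemma toeplitz_apply_not_le {n : ℕ} (f : ℕ → ℂ) {i j : Fin n} (h : ¬ i ≤ j) :
    toeplitz n f i j = 0 := by
  simp [toeplitz, h]

lemma toeplitz_congr {n : ℕ} {f g : ℕ → ℂ} (h : ∀ k < n, f k = g k) :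
    toeplitz n f = toeplitz n g := by
  ext i j
  by_cases hij : i ≤ j
  · rw [toeplitz_apply_le _ hij, toeplitz_apply_le _ hij, h]
    omega
  · rw [toeplitz_apply_not_le _ hij, toeplitz_apply_not_le _ hij]

/-- Only the indices i ≤ l ≤ j contribute to entry (i, j), and k = l - i turns that sum into the
Cauchy product. -/
lemma toeplitz_mul (n : ℕ) (f g : PowerSeries ℂ) :
    toeplitz n (fun k => PowerSeries.coeff k f) * toeplitz n (fun k => PowerSeries.coeff k g) =
      toeplitz n (fun k => PowerSeries.coeff k (f * g)) := by
  ext i j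
  rw [Matrix.mul_apply]
  by_cases hij : i ≤ j
  · rw [toeplitz_apply_le _ hij, PowerSeries.coeff_mul,
      Finset.Nat.sum_antidiagonal_eq_sum_range_succ_mk]
    have h1 : ∀ l : Fin n, toeplitz n (fun k => PowerSeries.coeff k f) i l *
        toeplitz n (fun k => PowerSeries.coeff k g) l j =
        if l ∈ Finset.Icc i j then PowerSeries.coeff ((l : ℕ) - i) f *
          PowerSeries.coeff ((j : ℕ) - l) g else 0 := by
      intro l
      by_cases h1 : i ≤ l <;> by_cases h2 : l ≤ j <;> simp [toeplitz, h1, h2]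
    rw [Finset.sum_congr rfl fun l _ => h1 l, Finset.sum_ite_mem, Finset.univ_inter]
    have hij' : (i : ℕ) ≤ j := hij
    refine Finset.sum_bij' (fun l _ => (l : ℕ) - i) (fun k hk => ⟨i + k, ?_⟩) ?_ ?_ ?_ ?_ ?_
    · simp only [Finset.mem_range] at hk
      omega
    · intro l hl
      simp only [Finset.mem_Icc, Fin.le_def, Finset.mem_range] at hl ⊢
      omega
    · intro k hk
      simp only [Finset.mem_Icc, Fin.le_def, Finset.mem_range] at hk ⊢
      omega
    · intro l hl
      simp only [Finset.mem_Icc, Fin.le_def] at hl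
      ext
      simp only
      omega
    · intro k hk
      simp
    · intro l hl
      simp only [Finset.mem_Icc, Fin.le_def] at hl
      congr 3
      omega
  · rw [toeplitz_apply_not_le _ hij]
    refine Finset.sum_eq_zero fun l _ => ?_
    by_cases h1 : i ≤ l
    · rw [toeplitz_apply_not_le (i := l) (j := j) _ fun h => hij (h1.trans h), mul_zero]
    · rw [toeplitz_apply_not_le _ h1, zero_mul]

lemma toeplitz_one (n : ℕ) : toeplitz n (fun k => PowerSeries.coeff k (1 : PowerSeries ℂ)) = 1 := by
  ext i j
  simp only [toeplitz, PowerSeries.coeff_one, Matrix.of_apply, Matrix.one_apply, Fin.le_def,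
    Fin.ext_iff]
  split_ifs <;> first | rfl | omega

lemma toeplitz_pow (n : ℕ) (f : PowerSeries ℂ) (m : ℕ) :
    toeplitz n (fun k => PowerSeries.coeff k f) ^ m =
      toeplitz n (fun k => PowerSeries.coeff k (f ^ m)) := by
  induction m with
  | zero => rw [pow_zero, pow_zero, toeplitz_one]
  | succ m ih => rw [pow_succ, ih, toeplitz_mul, pow_succ]

lemma hasSum_matrix_exp_apply {n : ℕ} (A : Matrix (Fin n) (Fin n) ℂ) (i j : Fin n) :
    HasSum (fun m : ℕ => ((m.factorial : ℂ)⁻¹) * (A ^ m) i j) (NormedSpace.exp A i j) := by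
  -- Any Banach algebra norm would do; convergence in this one is entrywise.
  let _ : NormedRing (Matrix (Fin n) (Fin n) ℂ) := Matrix.linftyOpNormedRing
  let _ : NormedAlgebra ℂ (Matrix (Fin n) (Fin n) ℂ) := Matrix.linftyOpNormedAlgebra
  have h := NormedSpace.exp_series_hasSum_exp' (𝕂 := ℂ) A
  exact (Pi.hasSum.1 ((Pi.hasSum.1 h) i)) j

/-- The series of the `k`-th coefficients of `f ^ m / m!` converges to an entry of the exponential
of a Toeplitz matrix. -/
lemma hasSum_coeff_pow (f : PowerSeries ℂ) (k : ℕ) :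
    HasSum (fun m : ℕ => ((m.factorial : ℂ)⁻¹) * PowerSeries.coeff k (f ^ m))
      (NormedSpace.exp (toeplitz (k + 1) (fun k => PowerSeries.coeff k f)) 0 (Fin.last k)) := by
  have h := hasSum_matrix_exp_apply (toeplitz (k + 1) (fun k => PowerSeries.coeff k f)) 0
    (Fin.last k)
  simpa [toeplitz_pow, toeplitz_apply_le] using h

/-- The exponential of an upper triangular Toeplitz matrix, by the recursion for the coefficients
of the exponential of a power series. -/
lemma exp_toeplitz {n : ℕ} {f g : ℕ → ℂ} (h0 : g 0 = Complex.exp (f 0))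
    (hrec : ∀ k, k + 1 < n → ((k : ℂ) + 1) * g (k + 1) =
      ∑ p ∈ Finset.HasAntidiagonal.antidiagonal k, g p.1 * (((p.2 : ℂ) + 1) * f (p.2 + 1))) :
    NormedSpace.exp (toeplitz n f) = toeplitz n g := by
  set F : PowerSeries ℂ := PowerSeries.mk f with hF
  -- `c k` is the k-th coefficient of exp(F), read off the corner of a matrix exponential of size k
  -- + 1; its convergence thus comes for free.
  set c : ℕ → ℂ := fun k =>
    NormedSpace.exp (toeplitz (k + 1) (fun k => PowerSeries.coeff k F)) 0 (Fin.last k) with hc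
  have hsum : ∀ k, HasSum (fun m : ℕ => ((m.factorial : ℂ)⁻¹) * PowerSeries.coeff k (F ^ m)) (c k) :=
    fun k => hasSum_coeff_pow F k
  have hfF : f = fun k => PowerSeries.coeff k F := by
    ext k
    simp [hF]
  have hc0 : c 0 = Complex.exp (f 0) := by
    refine (hsum 0).unique ?_
    have := NormedSpace.exp_series_hasSum_exp' (𝕂 := ℂ) (f 0)
    rw [← Complex.exp_eq_exp_ℂ] at this
    simpa [hF, PowerSeries.coeff_zero_eq_constantCoeff] using this
  have hcrec : ∀ k : ℕ, ((k : ℂ) + 1) * c (k + 1) =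
      ∑ p ∈ Finset.HasAntidiagonal.antidiagonal k, c p.1 * (((p.2 : ℂ) + 1) * f (p.2 + 1)) := by
    intro k
    have h1 : HasSum (fun m : ℕ => ((k : ℂ) + 1) *
        (((m.factorial : ℂ)⁻¹) * PowerSeries.coeff (k + 1) (F ^ m))) (((k : ℂ) + 1) * c (k + 1)) :=
      (hsum (k + 1)).mul_left _
    have h2 : HasSum (fun m : ℕ => ∑ p ∈ Finset.HasAntidiagonal.antidiagonal k,
        (((m.factorial : ℂ)⁻¹) * PowerSeries.coeff p.1 (F ^ m)) * (((p.2 : ℂ) + 1) * f (p.2 + 1)))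
        (∑ p ∈ Finset.HasAntidiagonal.antidiagonal k, c p.1 * (((p.2 : ℂ) + 1) * f (p.2 + 1))) :=
      hasSum_sum fun p _ => (hsum p.1).mul_right _
    -- The term m = 0 vanishes. After the shift, (F^(m+1))' = (m+1) F^m F' cancels a factor of
    -- (m+1)!, so the recursion is the series form of (exp F)' = exp(F) F'.
    have h3 := (hasSum_nat_add_iff' 1).2 h1
    simp only [Finset.range_one, Finset.sum_singleton, pow_zero, PowerSeries.coeff_one,
      Nat.succ_ne_zero, if_false, mul_zero, sub_zero] at h3
    refine h3.unique (h2.congr_fun ?_)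
    intro m
    have hd := congrArg (PowerSeries.coeff k) (PowerSeries.derivative_pow F (m + 1))
    rw [PowerSeries.coeff_derivative] at hd
    have hm : ((m.factorial : ℂ)) ≠ 0 := by exact_mod_cast m.factorial_ne_zero
    have hm1 : ((m : ℂ) + 1) ≠ 0 := by exact_mod_cast m.succ_ne_zero
    have hd' : PowerSeries.coeff k (((m + 1 : ℕ) : PowerSeries ℂ) * F ^ (m + 1 - 1) *
        PowerSeries.derivative ℂ F) = ((m : ℂ) + 1) * ∑ p ∈ Finset.HasAntidiagonal.antidiagonal k,
          PowerSeries.coeff p.1 (F ^ m) * (((p.2 : ℂ) + 1) * f (p.2 + 1)) := by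
      rw [mul_assoc, ← map_natCast (PowerSeries.C (R := ℂ)), PowerSeries.coeff_C_mul,
        PowerSeries.coeff_mul]
      simp only [PowerSeries.coeff_derivative, hfF]
      push_cast
      congr 1
      refine Finset.sum_congr rfl fun p _ => ?_
      simp
      left; ring
    rw [hd'] at hd
    rw [Nat.factorial_succ]
    push_cast
    have : ((k : ℂ) + 1) * ((((m : ℂ) + 1) * (m.factorial : ℂ))⁻¹ *
        PowerSeries.coeff (k + 1) (F ^ (m + 1))) = (((m : ℂ) + 1) * (m.factorial : ℂ))⁻¹ *
        (PowerSeries.coeff (k + 1) (F ^ (m + 1)) * ((k : ℂ) + 1)) := by ring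
    rw [this, hd, Finset.mul_sum, Finset.mul_sum]
    refine Finset.sum_congr rfl fun p _ => ?_
    field_simp
  have hgc : ∀ k, k < n → g k = c k := by
    intro k
    induction k using Nat.strong_induction_on with
    | _ k ih =>
      intro hk
      rcases k with _ | k
      · rw [h0, hc0]
      · have hk1 : ((k : ℂ) + 1) ≠ 0 := by exact_mod_cast k.succ_ne_zero
        refine mul_left_cancel₀ hk1 ?_
        rw [hrec k hk, hcrec k]
        refine Finset.sum_congr rfl fun p hp => ?_
        have := Finset.HasAntidiagonal.mem_antidiagonal.1 hp
        rw [ih p.1 (by omega) (by omega)]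
  rw [toeplitz_congr hgc]
  ext i j
  have h := hasSum_matrix_exp_apply (toeplitz n f) i j
  refine h.unique ?_
  rw [hfF]
  simp only [toeplitz_pow]
  by_cases hij : i ≤ j
  · simpa only [toeplitz_apply_le _ hij] using hsum _
  · simpa only [toeplitz_apply_not_le _ hij, mul_zero] using hasSum_zero

lemma jordanBlock_eq_toeplitz (n : ℕ) (lam : ℂ) :
    jordanBlock n lam = toeplitz n (fun k => if k = 0 then lam else if k = 1 then 1 else 0) := by
  ext i j
  simp only [jordanBlock, toeplitz, Matrix.of_apply, Fin.le_def, Fin.ext_iff]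
  split_ifs <;> first | rfl | omega

/-- Only the coefficients of order 0 and 1 are nonzero, so the recursion collapses to (k+1) g(k+1) =
-t g(k). -/
lemma exp_neg_smul_jordanBlock (n : ℕ) (lam : ℂ) (t : ℝ) :
    NormedSpace.exp (-((t : ℂ) • jordanBlock n lam)) =
      toeplitz n (fun k => (-(t : ℂ)) ^ k * Complex.exp (lam * -(t : ℂ)) / k.factorial) := by
  have h : -((t : ℂ) • jordanBlock n lam) =
      toeplitz n (fun k => if k = 0 then lam * -(t : ℂ) else if k = 1 then -(t : ℂ) else 0) := by
    rw [jordanBlock_eq_toeplitz]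
    ext i j
    simp only [toeplitz, Matrix.of_apply, Matrix.neg_apply, Matrix.smul_apply, smul_eq_mul]
    split_ifs <;> ring
  rw [h]
  refine exp_toeplitz (by simp) fun k _ => ?_
  rw [Finset.sum_eq_single (k, 0)]
  · have hk1 : ((k : ℂ) + 1) ≠ 0 := by exact_mod_cast k.succ_ne_zero
    have hk : (k.factorial : ℂ) ≠ 0 := by exact_mod_cast k.factorial_ne_zero
    simp [Nat.factorial_succ]
    field_simp
    ring
  · rintro ⟨a, b⟩ hp hne
    have : b ≠ 0 := by
      rintro rfl
      simp at hp
      simp [hp] at hne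
    simp [this]
  · simp

end Toeplitz

/-! ### The exponential exp(-x) on [0, ∞], with exp(-∞) = 0 -/

section ExpNeg

/-- The function `x ↦ exp (-x)` on `[0, ∞]`. -/
noncomputable def expNeg (x : ℝ≥0∞) : ℝ≥0∞ := EReal.exp (-(x : EReal))

@[simp] lemma expNeg_zero : expNeg 0 = 1 := by simp [expNeg]

@[simp] lemma expNeg_top : expNeg ∞ = 0 := by simp [expNeg]

lemma expNeg_coe (x : ℝ≥0) : expNeg x = ENNReal.ofReal (Real.exp (-x)) := by
  have : ((x : ℝ≥0∞) : EReal) = ((x : ℝ) : EReal) := rfl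
  rw [expNeg, this, ← EReal.coe_neg, EReal.exp_coe]

lemma expNeg_of_ne_top {x : ℝ≥0∞} (hx : x ≠ ∞) :
    expNeg x = ENNReal.ofReal (Real.exp (-x.toReal)) := by
  lift x to ℝ≥0 using hx
  exact expNeg_coe x

lemma expNeg_add (x y : ℝ≥0∞) : expNeg (x + y) = expNeg x * expNeg y := by
  rw [expNeg, EReal.coe_ennreal_add, EReal.neg_add (by simp) (by simp), sub_eq_add_neg,
    EReal.exp_add]
  rfl

lemma expNeg_le_one (x : ℝ≥0∞) : expNeg x ≤ 1 := by
  rw [expNeg, EReal.exp_le_one_iff, EReal.neg_le_zero]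
  exact EReal.coe_ennreal_nonneg x

lemma expNeg_ne_top (x : ℝ≥0∞) : expNeg x ≠ ∞ :=
  ((expNeg_le_one x).trans_lt ENNReal.one_lt_top).ne

lemma continuous_expNeg : Continuous expNeg :=
  ENNReal.continuous_exp.comp (continuous_neg.comp continuous_coe_ennreal_ereal)

lemma measurable_expNeg : Measurable expNeg := continuous_expNeg.measurable

lemma antitone_expNeg : Antitone expNeg := fun x y h => by
  rw [expNeg, expNeg, EReal.exp_le_exp_iff, EReal.neg_le_neg_iff]
  exact EReal.coe_ennreal_le_coe_ennreal_iff.2 h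

lemma expNeg_eq_zero_iff {x : ℝ≥0∞} : expNeg x = 0 ↔ x = ∞ := by
  rw [expNeg, EReal.exp_eq_zero_iff, EReal.neg_eq_bot_iff, EReal.coe_ennreal_eq_top_iff]

lemma expNeg_sum {ι : Type*} (s : Finset ι) (f : ι → ℝ≥0∞) :
    expNeg (∑ i ∈ s, f i) = ∏ i ∈ s, expNeg (f i) := by
  classical
  induction s using Finset.induction_on with
  | empty => simp
  | insert i s hi ih => rw [Finset.sum_insert hi, Finset.prod_insert hi, expNeg_add, ih]

lemma expNeg_mul_natCast (c : ℝ≥0∞) (k : ℕ) : expNeg (c * k) = expNeg c ^ k := by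
  induction k with
  | zero => simp
  | succ k ih => rw [Nat.cast_succ, mul_add, mul_one, expNeg_add, ih, pow_succ]

/-- Lets an averaged mark transform v be written as exp(-u), including v = 0 with u = ∞. -/
lemma expNeg_toENNReal_neg_log {v : ℝ≥0∞} (hv : v ≤ 1) :
    expNeg (-ENNReal.log v).toENNReal = v := by
  have h : 0 ≤ -ENNReal.log v := by
    rw [EReal.neg_nonneg]
    exact ENNReal.log_le_zero_iff.2 hv
  rw [expNeg, EReal.coe_toENNReal h, neg_neg, ENNReal.exp_log]

end ExpNeg

/-! ### The Laplace functional of a Poisson point process -/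

section Poisson

/-- With q = exp(-c), the exponential series sums exp(-r) (rq)^k / k! to exp(-r(1 - q)). The case c
= ∞ is q = 0, with 0^0 = 1. -/
lemma lintegral_expNeg_poissonMeasure (r : ℝ≥0) (c : ℝ≥0∞) :
    ∫⁻ k : ℕ, expNeg (c * k) ∂(poissonMeasure r) = expNeg (r * (1 - expNeg c)) := by
  set q : ℝ := (expNeg c).toReal with hq
  have hq0 : 0 ≤ q := ENNReal.toReal_nonneg
  have hqe : expNeg c = ENNReal.ofReal q := (ENNReal.ofReal_toReal (expNeg_ne_top c)).symm
  have hq1 : q ≤ 1 := by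
    have := ENNReal.toReal_mono ENNReal.one_ne_top (expNeg_le_one c)
    simpa using this
  have h1 : (r : ℝ≥0∞) * (1 - expNeg c) = ENNReal.ofReal (r * (1 - q)) := by
    rw [hqe, ENNReal.ofReal_mul r.coe_nonneg, ENNReal.ofReal_coe_nnreal,
      ENNReal.ofReal_sub _ hq0, ENNReal.ofReal_one]
  have hnn : 0 ≤ (r : ℝ) * (1 - q) := mul_nonneg r.coe_nonneg (by linarith)
  rw [h1, expNeg_of_ne_top ENNReal.ofReal_ne_top, ENNReal.toReal_ofReal hnn, poissonMeasure,
    lintegral_sum_measure]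
  simp only [lintegral_smul_measure, lintegral_dirac, expNeg_mul_natCast, hqe, smul_eq_mul]
  have h2 : ∀ k : ℕ, ENNReal.ofReal (Real.exp (-r) * (r : ℝ) ^ k / k.factorial) *
      ENNReal.ofReal q ^ k =
      ENNReal.ofReal (Real.exp (-r) * (((r : ℝ) * q) ^ k / k.factorial)) := by
    intro k
    rw [← ENNReal.ofReal_pow hq0, ← ENNReal.ofReal_mul (by positivity)]
    congr 1
    rw [mul_pow]
    ring
  simp only [h2]
  have hs : HasSum (fun k : ℕ => Real.exp (-r) * (((r : ℝ) * q) ^ k / k.factorial))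
      (Real.exp (-(r * (1 - q)))) := by
    have := (NormedSpace.expSeries_div_hasSum_exp ((r : ℝ) * q)).mul_left (Real.exp (-r))
    rw [← Real.exp_eq_exp_ℝ, ← Real.exp_add] at this
    rwa [show -(r : ℝ) + r * q = -(r * (1 - q)) by ring] at this
  rw [← ENNReal.ofReal_tsum_of_nonneg (fun k => by positivity) hs.summable, hs.tsum_eq]

variable {Ω : Type*} [MeasurableSpace Ω] {d : ℕ} {P : Measure Ω}
  {Φ : Ω → Measure (EuclideanSpace ℝ (Fin d))} {Λ : Measure (EuclideanSpace ℝ (Fin d))}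

lemma IsPoissonPointProcess.measurable_apply (hΦ : IsPoissonPointProcess P Φ Λ)
    {B : Set (EuclideanSpace ℝ (Fin d))} (hB : MeasurableSet B) : Measurable fun ω => Φ ω B :=
  (Measure.measurable_coe hB).comp hΦ.measurable

lemma IsPoissonPointProcess.lintegral_expNeg_apply (hΦ : IsPoissonPointProcess P Φ Λ)
    {B : Set (EuclideanSpace ℝ (Fin d))} (hB : MeasurableSet B) (hΛ : Λ B < ∞) (c : ℝ≥0∞) :
    ∫⁻ ω, expNeg (c * Φ ω B) ∂P = expNeg (Λ B * (1 - expNeg c)) := by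
  have hf : Measurable fun x : ℝ≥0∞ => expNeg (c * x) :=
    measurable_expNeg.comp (measurable_const.mul measurable_id)
  have h := lintegral_map (μ := P) hf (hΦ.measurable_apply hB)
  rw [← h, hΦ.map_apply B hB hΛ, lintegral_map hf (by fun_prop), lintegral_expNeg_poissonMeasure,
    ENNReal.coe_toNNReal hΛ.ne]

/-- The points of a Poisson point process almost surely avoid null sets of the intensity. -/
lemma IsPoissonPointProcess.ae_apply_eq_zero (hΦ : IsPoissonPointProcess P Φ Λ)
    {B : Set (EuclideanSpace ℝ (Fin d))} (hB : MeasurableSet B) (hΛ : Λ B = 0) :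
    ∀ᵐ ω ∂P, Φ ω B = 0 := by
  have h := hΦ.map_apply B hB (by simp [hΛ])
  have h0 : (P.map fun ω => Φ ω B) {0}ᶜ = 0 := by
    rw [h, hΛ, ENNReal.toNNReal_zero, Measure.map_apply (by fun_prop) (by measurability)]
    have : (fun k : ℕ => (k : ℝ≥0∞)) ⁻¹' {0}ᶜ = ({0} : Set ℕ)ᶜ := by
      ext k
      simp
    rw [this, prob_compl_eq_zero_iff (by measurability), poissonMeasure_singleton]
    simp
  rw [Measure.map_apply (hΦ.measurable_apply hB) (by measurability)] at h0
  exact h0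

/-- The integral of u is a linear combination of the counts of its disjoint level sets, so the
expectation factors by independence. The level set of 0 may have infinite intensity, but it
contributes the factor 1. -/
lemma IsPoissonPointProcess.lintegral_expNeg_simpleFunc (hΦ : IsPoissonPointProcess P Φ Λ)
    (u : SimpleFunc (EuclideanSpace ℝ (Fin d)) ℝ≥0∞) (hu : ∀ c ≠ 0, Λ (u ⁻¹' {c}) < ∞) :
    ∫⁻ ω, expNeg (∫⁻ x, u x ∂(Φ ω)) ∂P = expNeg (∫⁻ x, (1 - expNeg (u x)) ∂Λ) := by
  let e := u.range.equivFin
  have hind := hΦ.indep u.range.card (fun i => u ⁻¹' {((e.symm i : u.range) : ℝ≥0∞)})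
    (fun i => u.measurableSet_preimage _) (by
      intro i j hij
      refine Disjoint.preimage _ ?_
      rw [Set.disjoint_singleton]
      intro h
      exact hij (e.symm.injective (Subtype.ext h)))
  have hind2 := hind.comp (fun i x => expNeg (((e.symm i : u.range) : ℝ≥0∞) * x))
    (fun i => measurable_expNeg.comp (measurable_const.mul measurable_id))
  have h1 : ∀ ω, expNeg (∫⁻ x, u x ∂(Φ ω)) = ∏ i : Fin u.range.card,
      expNeg (((e.symm i : u.range) : ℝ≥0∞) * Φ ω (u ⁻¹' {((e.symm i : u.range) : ℝ≥0∞)})) := by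
    intro ω
    have hl : ∫⁻ x, u x ∂(Φ ω) = ∑ c ∈ u.range, c * Φ ω (u ⁻¹' {c}) :=
      SimpleFunc.lintegral_eq_lintegral u (Φ ω)
    rw [hl, expNeg_sum, ← Finset.prod_coe_sort]
    exact (Equiv.prod_comp e.symm (fun c : u.range =>
      expNeg ((c : ℝ≥0∞) * Φ ω (u ⁻¹' {(c : ℝ≥0∞)})))).symm
  have h2 : ∫⁻ x, (1 - expNeg (u x)) ∂Λ =
      ∑ c ∈ u.range, (1 - expNeg c) * Λ (u ⁻¹' {c}) := by
    rw [← SimpleFunc.map_lintegral, ← SimpleFunc.lintegral_eq_lintegral]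
    rfl
  simp only [h1]
  have h3 := lintegral_prod_eq_prod_lintegral_of_indepFun Finset.univ _ hind2 (fun i =>
    (measurable_expNeg.comp (measurable_const.mul measurable_id)).comp
      (hΦ.measurable_apply (u.measurableSet_preimage _)))
  refine h3.trans ?_
  rw [h2, expNeg_sum, ← Finset.prod_coe_sort u.range, ← Equiv.prod_comp e.symm (fun c : u.range =>
      expNeg ((1 - expNeg (c : ℝ≥0∞)) * Λ (u ⁻¹' {(c : ℝ≥0∞)})))]
  have hP : IsProbabilityMeasure P := hind.isProbabilityMeasure
  refine Finset.prod_congr rfl fun i _ => ?_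
  simp only [Function.comp_apply]
  by_cases hc : ((e.symm i : u.range) : ℝ≥0∞) = 0
  · simp [hc]
  · rw [hΦ.lintegral_expNeg_apply (u.measurableSet_preimage _) (hu _ hc), mul_comm]

/-- The Laplace functional of a Poisson point process. -/
theorem IsPoissonPointProcess.lintegral_expNeg [SigmaFinite Λ] (hΦ : IsPoissonPointProcess P Φ Λ)
    {u : EuclideanSpace ℝ (Fin d) → ℝ≥0∞} (hu : Measurable u) :
    ∫⁻ ω, expNeg (∫⁻ x, u x ∂(Φ ω)) ∂P = expNeg (∫⁻ x, (1 - expNeg (u x)) ∂Λ) := by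
  have hP : IsProbabilityMeasure P :=
    (hΦ.indep 0 (fun _ => ∅) (fun _ => MeasurableSet.empty) (fun i => i.elim0)).isProbabilityMeasure
  -- Restriction to the spanning sets gives the nonzero level sets finite intensity and keeps the
  -- approximation increasing in m.
  let v : ℕ → SimpleFunc (EuclideanSpace ℝ (Fin d)) ℝ≥0∞ := fun m =>
    (SimpleFunc.eapprox u m).restrict (spanningSets Λ m)
  have hv : ∀ m x, v m x = (spanningSets Λ m).indicator (SimpleFunc.eapprox u m) x := fun m x => by
    rw [SimpleFunc.restrict_apply _ (measurableSet_spanningSets Λ m)]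
  have hmono : ∀ x, Monotone fun m => v m x := by
    intro x m m' h
    simp only [hv]
    refine (Set.indicator_le_indicator_of_subset (monotone_spanningSets Λ h)
      (fun _ => zero_le) x).trans (Set.indicator_le_indicator ?_)
    exact SimpleFunc.monotone_eapprox u h x
  have hlim : ∀ x, Tendsto (fun m => v m x) atTop (𝓝 (u x)) := by
    intro x
    refine (SimpleFunc.tendsto_eapprox hu x).congr' ?_
    filter_upwards [eventually_ge_atTop (spanningSetsIndex Λ x)] with m hm
    rw [hv, Set.indicator_of_mem]
    exact monotone_spanningSets Λ hm (mem_spanningSetsIndex Λ x)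
  have hstep : ∀ m, ∫⁻ ω, expNeg (∫⁻ x, v m x ∂(Φ ω)) ∂P =
      expNeg (∫⁻ x, (1 - expNeg (v m x)) ∂Λ) := by
    refine fun m => hΦ.lintegral_expNeg_simpleFunc (v m) fun c hc => ?_
    refine (measure_mono ?_).trans_lt (measure_spanningSets_lt_top Λ m)
    intro x hx
    by_contra hx'
    refine hc ?_
    rw [← (show v m x = c from hx), hv, Set.indicator_of_notMem hx']
  have hΦm : ∀ m, Measurable fun ω => ∫⁻ x, v m x ∂(Φ ω) := fun m =>
    (Measure.measurable_lintegral (v m).measurable).comp hΦ.measurable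
  have hL : Tendsto (fun m => ∫⁻ ω, expNeg (∫⁻ x, v m x ∂(Φ ω)) ∂P) atTop
      (𝓝 (∫⁻ ω, expNeg (∫⁻ x, u x ∂(Φ ω)) ∂P)) := by
    refine tendsto_lintegral_of_dominated_convergence (fun _ => 1)
      (fun m => measurable_expNeg.comp (hΦm m))
      (fun m => Eventually.of_forall fun ω => expNeg_le_one _) (by simp) ?_
    refine Eventually.of_forall fun ω => (continuous_expNeg.tendsto _).comp ?_
    exact lintegral_tendsto_of_tendsto_of_monotone (fun m => (v m).measurable.aemeasurable)
      (Eventually.of_forall hmono) (Eventually.of_forall hlim)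
  have hR : Tendsto (fun m => expNeg (∫⁻ x, (1 - expNeg (v m x)) ∂Λ)) atTop
      (𝓝 (expNeg (∫⁻ x, (1 - expNeg (u x)) ∂Λ))) := by
    refine (continuous_expNeg.tendsto _).comp ?_
    refine lintegral_tendsto_of_tendsto_of_monotone (fun m =>
      (measurable_const.sub (measurable_expNeg.comp (v m).measurable)).aemeasurable)
      (Eventually.of_forall fun x m m' h => tsub_le_tsub_left (antitone_expNeg (hmono x h)) _)
      (Eventually.of_forall fun x => ?_)
    exact ENNReal.Tendsto.sub tendsto_const_nhds ((continuous_expNeg.tendsto _).comp (hlim x))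
      (Or.inl ENNReal.one_ne_top)
  exact tendsto_nhds_unique hL (hR.congr fun m => (hstep m).symm)

end Poisson

/-! ### Averaging the independent marks -/

section Marking

variable {Ω : Type*} [MeasurableSpace Ω] {d : ℕ} {P : Measure Ω}
  {Φ : Ω → Measure (EuclideanSpace ℝ (Fin d))} {Λ : Measure (EuclideanSpace ℝ (Fin d))}
  {N : Ω → ℕ∞} {X : ℕ → Ω → EuclideanSpace ℝ (Fin d)} {M : ℕ → Ω → ℝ≥0}

lemma measurable_points (hN : Measurable N) (hX : ∀ k, Measurable (X k)) :
    Measurable (points N X) :=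
  hN.prodMk (measurable_pi_lambda _ fun k =>
    Measurable.ite (hN (MeasurableSet.of_discrete (s := Set.Ioi (k : ℕ∞)))) (hX k) measurable_const)

lemma measurableSet_le_card_and_points (hN : Measurable N) (hX : ∀ k, Measurable (X k)) (m : ℕ)
    {A : Set (ℕ∞ × (ℕ → EuclideanSpace ℝ (Fin d)))} (hA : MeasurableSet A) :
    MeasurableSet {ω | (m : ℕ∞) ≤ N ω ∧ points N X ω ∈ A} :=
  (hN (MeasurableSet.of_discrete (s := Set.Ici (m : ℕ∞)))).inter (measurable_points hN hX hA)

/-- Points of a Poisson point process almost surely have every property that holds almost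
everywhere for the intensity measure. -/
lemma IsEnumeration.ae_forall_point (hX : IsEnumeration P Φ N X)
    (hΦ : IsPoissonPointProcess P Φ Λ) {p : EuclideanSpace ℝ (Fin d) → Prop}
    (hp : ∀ᵐ x ∂Λ, p x) : ∀ᵐ ω ∂P, ∀ k : ℕ, (k : ℕ∞) < N ω → p (X k ω) := by
  obtain ⟨B, hpB, hB, hB0⟩ := exists_measurable_superset_of_null hp
  filter_upwards [hΦ.ae_apply_eq_zero hB hB0, hX.eq_countingMeasure] with ω h1 h2 k hk
  by_contra hpx
  have hmem : X k ω ∈ B := hpB hpx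
  rw [h2, countingMeasure, Measure.sum_apply _ hB, ENNReal.tsum_eq_zero] at h1
  simpa [hk, hB, hmem] using h1 k

/-- Only the laws at points of Φ enter, and these points a.s. avoid Λ-null sets. This allows the law
of H(x) to be replaced by a kernel. -/
lemma IsIndependentMarking.congr_law {law law' : EuclideanSpace ℝ (Fin d) → Measure ℝ≥0}
    (hM : IsIndependentMarking P N X M law) (hX : IsEnumeration P Φ N X)
    (hΦ : IsPoissonPointProcess P Φ Λ) (h : law =ᵐ[Λ] law') :
    IsIndependentMarking P N X M law' where
  measurable_mark := hM.measurable_mark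
  measure_inter m A U hA hU := by
    rw [hM.measure_inter m A U hA hU]
    refine setLIntegral_congr_fun_ae
      (measurableSet_le_card_and_points hX.measurable_card hX.measurable_point m hA) ?_
    filter_upwards [hX.ae_forall_point hΦ h] with ω hω hmem
    refine Finset.prod_congr rfl fun i _ => ?_
    rw [hω i (lt_of_lt_of_le (by exact_mod_cast i.2) hmem.1)]

variable {κ : Kernel (EuclideanSpace ℝ (Fin d)) ℝ≥0}

/-- Independent marks integrate products of functions, one function for each of the first `m`
marks, of which those outside the finite set `T` are indicators. -/
lemma IsIndependentMarking.lintegral_prod_aux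
    (hM : IsIndependentMarking P N X M (fun x => κ x)) (hN : Measurable N)
    (hX : ∀ k, Measurable (X k)) (m : ℕ) {A : Set (ℕ∞ × (ℕ → EuclideanSpace ℝ (Fin d)))}
    (hA : MeasurableSet A) (T : Finset (Fin m)) :
    ∀ g : Fin m → ℝ≥0 → ℝ≥0∞, (∀ i, Measurable (g i)) →
      (∀ i ∉ T, ∃ U : Set ℝ≥0, MeasurableSet U ∧ g i = U.indicator 1) →
      ∫⁻ ω in {ω | (m : ℕ∞) ≤ N ω ∧ points N X ω ∈ A}, ∏ i, g i (M i ω) ∂P =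
        ∫⁻ ω in {ω | (m : ℕ∞) ≤ N ω ∧ points N X ω ∈ A},
          ∏ i : Fin m, ∫⁻ h, g i h ∂κ (X i ω) ∂P := by
  classical
  set S : Set Ω := {ω | (m : ℕ∞) ≤ N ω ∧ points N X ω ∈ A} with hS
  have hSm : MeasurableSet S := measurableSet_le_card_and_points hN hX m hA
  have hκm : ∀ {f : ℝ≥0 → ℝ≥0∞}, Measurable f → ∀ k,
      Measurable fun ω => ∫⁻ h, f h ∂κ (X k ω) := fun hf k =>
    hf.lintegral_kernel.comp (hX k)
  -- One factor at a time passes from an indicator to a measurable function. The base case is the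
  -- defining property of the marking; the step freezes the other factors as R and R' and uses
  -- linearity and monotone convergence in factor a.
  induction T using Finset.induction_on with
  | empty =>
    intro g _ hT
    choose U hU hgU using fun i => hT i (Finset.notMem_empty i)
    have h1 : ∀ ω, ∏ i, g i (M i ω) = {ω | ∀ i : Fin m, M i ω ∈ U i}.indicator 1 ω := by
      intro ω
      simp only [hgU, Set.indicator_apply, Pi.one_apply, Finset.prod_ite_zero]
      simp
    have h2 : MeasurableSet {ω | ∀ i : Fin m, M i ω ∈ U i} := by
      rw [Set.ofPred_forall]
      exact MeasurableSet.iInter fun i => hM.measurable_mark i (hU i)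
    have h3 := hM.measure_inter m A U hA hU
    simp only [h1]
    rw [lintegral_indicator_one h2, Measure.restrict_apply h2]
    have h4 : {ω | ∀ i : Fin m, M i ω ∈ U i} ∩ S =
        {ω | (m : ℕ∞) ≤ N ω ∧ points N X ω ∈ A ∧ ∀ i : Fin m, M i ω ∈ U i} := by
      ext ω
      simp only [hS, Set.mem_inter_iff, Set.mem_ofPred_eq]
      tauto
    rw [h4, h3]
    simp only [hgU, lintegral_indicator_one (hU _)]
    rfl
  | insert a T ha ih =>
    intro g hg hT
    let R : Ω → ℝ≥0∞ := fun ω => ∏ i ∈ Finset.univ.erase a, g i (M i ω)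
    let R' : Ω → ℝ≥0∞ := fun ω => ∏ i ∈ Finset.univ.erase a, ∫⁻ h, g i h ∂κ (X i ω)
    have hR : Measurable R :=
      Finset.measurable_prod _ fun i _ => (hg i).comp (hM.measurable_mark i)
    have hR' : Measurable R' := Finset.measurable_prod _ fun i _ => hκm (hg i) i
    have hp : ∀ {f : ℝ≥0 → ℝ≥0∞}, Measurable f → Measurable fun ω => f (M a ω) * R ω :=
      fun hf => (hf.comp (hM.measurable_mark a)).mul hR
    have hp' : ∀ {f : ℝ≥0 → ℝ≥0∞}, Measurable f →
        Measurable fun ω => (∫⁻ h, f h ∂κ (X a ω)) * R' ω := fun hf => (hκm hf a).mul hR'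
    suffices h : ∫⁻ ω in S, g a (M a ω) * R ω ∂P =
        ∫⁻ ω in S, (∫⁻ h, g a h ∂κ (X a ω)) * R' ω ∂P by
      have e1 : ∀ ω, g a (M a ω) * R ω = ∏ i : Fin m, g i (M i ω) := fun ω =>
        Finset.mul_prod_erase Finset.univ (fun i : Fin m => g i (M i ω)) (Finset.mem_univ a)
      have e2 : ∀ ω, (∫⁻ h, g a h ∂κ (X a ω)) * R' ω = ∏ i : Fin m, ∫⁻ h, g i h ∂κ (X i ω) :=
        fun ω => Finset.mul_prod_erase Finset.univ
          (fun i : Fin m => ∫⁻ h, g i h ∂κ (X i ω)) (Finset.mem_univ a)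
      simpa only [e1, e2] using h
    refine Measurable.ennreal_induction (motive := fun f => ∫⁻ ω in S, f (M a ω) * R ω ∂P =
        ∫⁻ ω in S, (∫⁻ h, f h ∂κ (X a ω)) * R' ω ∂P) ?_ ?_ ?_ (hg a)
    · intro c U hU
      have hind := ih (Function.update g a (U.indicator 1)) ?_ ?_
      · have e1 : ∀ ω, ∏ i, Function.update g a (U.indicator 1) i (M i ω) =
            U.indicator 1 (M a ω) * R ω := by
          intro ω
          rw [← Finset.mul_prod_erase _ _ (Finset.mem_univ a)]
          congr 1
          · simp
          · exact Finset.prod_congr rfl fun i hi => by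
              rw [Function.update_of_ne (Finset.ne_of_mem_erase hi)]
        have e2 : ∀ ω, ∏ i : Fin m, ∫⁻ h, Function.update g a (U.indicator 1) i h ∂κ (X i ω) =
            (∫⁻ h, U.indicator 1 h ∂κ (X a ω)) * R' ω := by
          intro ω
          rw [← Finset.mul_prod_erase _ _ (Finset.mem_univ a)]
          congr 1
          · simp
          · exact Finset.prod_congr rfl fun i hi => by
              rw [Function.update_of_ne (Finset.ne_of_mem_erase hi)]
        simp only [e1, e2] at hind
        have e3 : ∀ h : ℝ≥0, U.indicator (fun _ => c) h = c * U.indicator 1 h := fun h => by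
          by_cases hh : h ∈ U <;> simp [hh]
        have hone : Measurable (U.indicator (1 : ℝ≥0 → ℝ≥0∞)) := measurable_one.indicator hU
        simp only [e3, mul_assoc, lintegral_const_mul c hone]
        rw [lintegral_const_mul c (hp hone), hind,
          ← lintegral_const_mul c (hp' hone)]
      · intro i
        by_cases hi : i = a
        · subst hi
          simpa using measurable_one.indicator hU
        · simpa [hi] using hg i
      · intro i hi
        by_cases hia : i = a
        · subst hia
          exact ⟨U, hU, by simp⟩
        · rw [Function.update_of_ne hia]
          exact hT i (by simp [hia, hi])
    · intro f f' _ hf hf' h h'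
      simp only [Pi.add_apply, add_mul, lintegral_add_left hf]
      rw [lintegral_add_left (hp hf), h, h',
        ← lintegral_add_left (hp' hf)]
    · intro f hf hmono h
      have e1 : ∀ ω, (∫⁻ h, ⨆ k, f k h ∂κ (X a ω)) = ⨆ k, ∫⁻ h, f k h ∂κ (X a ω) := fun ω =>
        lintegral_iSup hf hmono
      simp only [e1, ENNReal.iSup_mul]
      rw [lintegral_iSup, lintegral_iSup]
      · simp only [h]
      · exact fun k => hp' (hf k)
      · intro k l hkl ω
        exact mul_le_mul_left (lintegral_mono (hmono hkl)) _
      · exact fun k => hp (hf k)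
      · intro k l hkl ω
        exact mul_le_mul_left (hmono hkl _) _

lemma IsIndependentMarking.lintegral_prod_le_card
    (hM : IsIndependentMarking P N X M (fun x => κ x)) (hN : Measurable N)
    (hX : ∀ k, Measurable (X k)) (m : ℕ) {A : Set (ℕ∞ × (ℕ → EuclideanSpace ℝ (Fin d)))}
    (hA : MeasurableSet A) {g : ℝ≥0 → ℝ≥0∞} (hg : Measurable g) :
    ∫⁻ ω in {ω | (m : ℕ∞) ≤ N ω ∧ points N X ω ∈ A}, ∏ k ∈ Finset.range m, g (M k ω) ∂P =
      ∫⁻ ω in {ω | (m : ℕ∞) ≤ N ω ∧ points N X ω ∈ A},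
        ∏ k ∈ Finset.range m, ∫⁻ h, g h ∂κ (X k ω) ∂P := by
  have h := hM.lintegral_prod_aux hN hX m hA Finset.univ (fun _ => g) (fun _ => hg) (by simp)
  simpa only [Finset.prod_range] using h

/-- Here m may exceed the number of points. Where N ≥ m + 1 all factors are genuine; elsewhere the
last factor is 1 and the case m applies. The set A is arbitrary so that it can absorb the event N <
m + 1. -/
lemma IsIndependentMarking.lintegral_prod
    (hM : IsIndependentMarking P N X M (fun x => κ x)) (hN : Measurable N)
    (hX : ∀ k, Measurable (X k)) {g : ℝ≥0 → ℝ≥0∞} (hg : Measurable g) (m : ℕ) :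
    ∀ {A : Set (ℕ∞ × (ℕ → EuclideanSpace ℝ (Fin d)))}, MeasurableSet A →
    ∫⁻ ω in points N X ⁻¹' A,
        ∏ k ∈ Finset.range m, (if (k : ℕ∞) < N ω then g (M k ω) else 1) ∂P =
      ∫⁻ ω in points N X ⁻¹' A,
        ∏ k ∈ Finset.range m, (if (k : ℕ∞) < N ω then ∫⁻ h, g h ∂κ (X k ω) else 1) ∂P := by
  induction m with
  | zero => simp
  | succ m ih =>
    intro A hA
    let C : Set (ℕ∞ × (ℕ → EuclideanSpace ℝ (Fin d))) := {q | ((m + 1 : ℕ) : ℕ∞) ≤ q.1}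
    have hC : MeasurableSet C := measurable_fst (MeasurableSet.of_discrete (s := Set.Ici ((m + 1 : ℕ) : ℕ∞)))
    have hpC : MeasurableSet (points N X ⁻¹' C) := measurable_points hN hX hC
    have hpA : MeasurableSet (points N X ⁻¹' A) := measurable_points hN hX hA
    have hin : points N X ⁻¹' A ∩ points N X ⁻¹' C =
        {ω | ((m + 1 : ℕ) : ℕ∞) ≤ N ω ∧ points N X ω ∈ A} := by
      ext ω
      simp only [C, points, Set.mem_inter_iff, Set.mem_preimage, Set.mem_ofPred_eq]
      tauto
    have hdiff : points N X ⁻¹' A \ points N X ⁻¹' C = points N X ⁻¹' (A \ C) := rfl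
    have hlt : ∀ {ω}, ω ∈ {ω | ((m + 1 : ℕ) : ℕ∞) ≤ N ω ∧ points N X ω ∈ A} →
        ∀ k ∈ Finset.range (m + 1), (k : ℕ∞) < N ω := fun hω k hk =>
      lt_of_lt_of_le (by exact_mod_cast Finset.mem_range.1 hk) hω.1
    have hnlt : ∀ {ω}, ω ∈ points N X ⁻¹' (A \ C) → ¬ (m : ℕ∞) < N ω := by
      intro ω hω h
      refine hω.2 ?_
      simpa [C, points] using Order.add_one_le_of_lt h
    have hmS := measurableSet_le_card_and_points hN hX (m + 1) hA
    have hmD : MeasurableSet (points N X ⁻¹' (A \ C)) := measurable_points hN hX (hA.diff hC)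
    rw [← lintegral_inter_add_sdiff _ (points N X ⁻¹' A) hpC,
      ← lintegral_inter_add_sdiff _ (points N X ⁻¹' A) hpC, hin, hdiff]
    congr 1
    · rw [setLIntegral_congr_fun hmS fun ω hω => Finset.prod_congr rfl fun k hk =>
          if_pos (hlt hω k hk),
        hM.lintegral_prod_le_card hN hX (m + 1) hA hg]
      exact setLIntegral_congr_fun hmS fun ω hω => Finset.prod_congr rfl fun k hk =>
          (if_pos (hlt hω k hk)).symm
    · rw [setLIntegral_congr_fun hmD (g := fun ω => ∏ k ∈ Finset.range m,
            (if (k : ℕ∞) < N ω then g (M k ω) else 1)) fun ω hω => by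
              simp only [Finset.prod_range_succ, if_neg (hnlt hω), mul_one],
        ih (hA.diff hC)]
      exact setLIntegral_congr_fun hmD fun ω hω => by
        simp only [Finset.prod_range_succ, if_neg (hnlt hω), mul_one]

lemma measurable_shotNoise (hN : Measurable N) (hM : ∀ k, Measurable (M k)) :
    Measurable (shotNoise N M) :=
  Measurable.tsum fun k => Measurable.ite (hN (MeasurableSet.of_discrete (s := Set.Ioi (k : ℕ∞))))
    (hM k).coe_nnreal_ennreal measurable_const

lemma tendsto_prod_expNeg (a : ℕ → ℝ≥0∞) :
    Tendsto (fun m => ∏ k ∈ Finset.range m, expNeg (a k)) atTop (𝓝 (expNeg (∑' k, a k))) := by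
  simp only [← expNeg_sum]
  exact (continuous_expNeg.tendsto _).comp (ENNReal.tendsto_nat_tsum a)

/-- The Laplace transform of the shot noise of an independently marked Poisson point process. -/
theorem lintegral_expNeg_shotNoise [IsProbabilityMeasure P] [SigmaFinite Λ] [IsMarkovKernel κ]
    (hΦ : IsPoissonPointProcess P Φ Λ) (hX : IsEnumeration P Φ N X)
    (hM : IsIndependentMarking P N X M (fun x => κ x)) (s : ℝ≥0∞) :
    ∫⁻ ω, expNeg (s * shotNoise N M ω) ∂P =
      expNeg (∫⁻ h : ℝ≥0, (1 - expNeg (s * h)) ∂(Λ.bind κ)) := by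
  have hg : Measurable fun h : ℝ≥0 => expNeg (s * h) :=
    measurable_expNeg.comp (measurable_const.mul measurable_coe_nnreal_ennreal)
  set v : EuclideanSpace ℝ (Fin d) → ℝ≥0∞ := fun x => ∫⁻ h : ℝ≥0, expNeg (s * h) ∂κ x with hv
  have hvm : Measurable v := hg.lintegral_kernel
  have hv1 : ∀ x, v x ≤ 1 := fun x =>
    (lintegral_mono fun h => expNeg_le_one _).trans (by simp)
  -- With u = -log v, averaging the marks replaces each s M k by u (X k), which leaves the Laplace
  -- functional of Φ at u. The averaging is done on finite products, and m → ∞ follows by dominated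
  -- convergence.
  set u : EuclideanSpace ℝ (Fin d) → ℝ≥0∞ := fun x => (-ENNReal.log (v x)).toENNReal with hu
  have hum : Measurable u := by
    exact measurable_ereal_toENNReal.comp ((ENNReal.measurable_log.comp hvm).neg)
  have huv : ∀ x, expNeg (u x) = v x := fun x => expNeg_toENNReal_neg_log (hv1 x)
  have hone : ∀ (f : ℕ → Ω → ℝ≥0∞) (ω : Ω) (k : ℕ), (if (k : ℕ∞) < N ω then expNeg (f k ω) else 1) =
      expNeg (if (k : ℕ∞) < N ω then f k ω else 0) := fun f ω k => by
    split_ifs <;> simp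
  have hmeas : ∀ f : ℕ → Ω → ℝ≥0∞, (∀ k, Measurable (f k)) → ∀ m, Measurable fun ω =>
      ∏ k ∈ Finset.range m, expNeg (if (k : ℕ∞) < N ω then f k ω else 0) := fun f hf m =>
    Finset.measurable_prod _ fun k _ => measurable_expNeg.comp
      (Measurable.ite (hX.measurable_card (MeasurableSet.of_discrete (s := Set.Ioi (k : ℕ∞)))) (hf k)
        measurable_const)
  have hlim : ∀ f : ℕ → Ω → ℝ≥0∞, (∀ k, Measurable (f k)) → Tendsto (fun m => ∫⁻ ω,
      ∏ k ∈ Finset.range m, expNeg (if (k : ℕ∞) < N ω then f k ω else 0) ∂P) atTop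
      (𝓝 (∫⁻ ω, expNeg (∑' k : ℕ, if (k : ℕ∞) < N ω then f k ω else 0) ∂P)) := fun f hf =>
    tendsto_lintegral_of_dominated_convergence (fun _ => 1) (hmeas f hf)
      (fun m => Eventually.of_forall fun ω => Finset.prod_le_one' fun k _ => expNeg_le_one _)
      (by simp) (Eventually.of_forall fun ω => tendsto_prod_expNeg _)
  have h1 := hlim (fun k ω => s * M k ω) fun k =>
    measurable_const.mul (hM.measurable_mark k).coe_nnreal_ennreal
  have h2 := hlim (fun k ω => u (X k ω)) fun k => hum.comp (hX.measurable_point k)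
  have h12 : ∀ m, ∫⁻ ω, ∏ k ∈ Finset.range m,
        expNeg (if (k : ℕ∞) < N ω then s * (M k ω : ℝ≥0∞) else 0) ∂P =
      ∫⁻ ω, ∏ k ∈ Finset.range m, expNeg (if (k : ℕ∞) < N ω then u (X k ω) else 0) ∂P := by
    intro m
    have := hM.lintegral_prod hX.measurable_card hX.measurable_point hg m MeasurableSet.univ
    simp only [Set.preimage_univ, Measure.restrict_univ] at this
    simp only [← hone (fun k ω => s * (M k ω : ℝ≥0∞)), ← hone (fun k ω => u (X k ω)), huv]
    exact this
  simp only [h12] at h1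
  have h3 := tendsto_nhds_unique h1 h2
  have h4 : ∀ ω, (∑' k : ℕ, if (k : ℕ∞) < N ω then s * (M k ω : ℝ≥0∞) else 0) =
      s * shotNoise N M ω := fun ω => by
    rw [shotNoise, ← ENNReal.tsum_mul_left]
    refine tsum_congr fun k => ?_
    split_ifs <;> simp
  simp only [h4] at h3
  rw [h3]
  have h5 : ∀ᵐ ω ∂P, expNeg (∑' k : ℕ, if (k : ℕ∞) < N ω then u (X k ω) else 0) =
      expNeg (∫⁻ x, u x ∂(Φ ω)) := by
    filter_upwards [hX.eq_countingMeasure] with ω hω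
    rw [hω, countingMeasure, lintegral_sum_measure]
    congr 1
    refine tsum_congr fun k => ?_
    split_ifs
    · rw [lintegral_dirac' _ hum]
    · simp
  rw [lintegral_congr_ae h5, hΦ.lintegral_expNeg hum]
  have h6 : Measurable fun h : ℝ≥0 => 1 - expNeg (s * h) := measurable_const.sub hg
  rw [Measure.lintegral_bind κ.measurable.aemeasurable h6.aemeasurable]
  congr 1
  refine lintegral_congr fun x => ?_
  rw [huv, lintegral_sub hg ((hv1 x).trans_lt ENNReal.one_lt_top).ne
    (Eventually.of_forall fun h => expNeg_le_one _)]
  simp [hv]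

end Marking

/-! ### Comparison of 1 - exp(-zh) with min(1, h) -/

section Bounds

/-- From exp(-y) ≤ 1/(1 + y) one gets y/(1 + y) ≤ 1 - exp(-y) at y = ah. Together with
`one_sub_exp_le_mul_min_one` this makes the integrability of 1 - exp(-ah) independent of a > 0. -/
lemma min_one_le_mul_one_sub_exp {a h : ℝ} (ha : 0 < a) (hh : 0 ≤ h) :
    min 1 h ≤ (1 + a) / a * (1 - Real.exp (-(a * h))) := by
  have hah : 0 ≤ a * h := by positivity
  have h1 : Real.exp (-(a * h)) ≤ 1 / (1 + a * h) := by
    rw [Real.exp_neg, ← one_div]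
    exact one_div_le_one_div_of_le (by positivity) (by linarith [Real.add_one_le_exp (a * h)])
  have h2 : a * h / (1 + a * h) ≤ 1 - Real.exp (-(a * h)) := by
    have : a * h / (1 + a * h) = 1 - 1 / (1 + a * h) := by field_simp; ring
    linarith
  refine le_trans ?_ (mul_le_mul_of_nonneg_left h2 (by positivity))
  rw [show (1 + a) / a * (a * h / (1 + a * h)) = (1 + a) * h / (1 + a * h) by field_simp,
    le_div_iff₀ (by positivity)]
  rcases le_total 1 h with h3 | h3
  · rw [min_eq_left h3]
    linarith
  · rw [min_eq_right h3]
    nlinarith [mul_nonneg hh (mul_nonneg ha.le (sub_nonneg.2 h3))]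

lemma one_sub_exp_le_mul_min_one {a h : ℝ} (hh : 0 ≤ h) :
    1 - Real.exp (-(a * h)) ≤ max 1 a * min 1 h := by
  rcases le_total 1 h with h3 | h3
  · rw [min_eq_left h3]
    linarith [le_max_left 1 a, Real.exp_pos (-(a * h))]
  · rw [min_eq_right h3]
    have := Real.add_one_le_exp (-(a * h))
    nlinarith [mul_le_mul_of_nonneg_right (le_max_right 1 a) hh]

lemma norm_cexp_neg_mul (z : ℂ) (h : ℝ) :
    ‖Complex.exp (-(z * (h : ℂ)))‖ = Real.exp (-(z.re * h)) := by
  rw [Complex.norm_exp]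
  simp

/-- The bound 2 always holds and suffices for h ≥ 1 or ‖z‖ h ≥ 1; otherwise ‖exp w - 1‖ ≤ 2‖w‖ for
‖w‖ ≤ 1. -/
lemma norm_one_sub_cexp_le {z : ℂ} (hz : 0 ≤ z.re) {h : ℝ} (hh : 0 ≤ h) :
    ‖1 - Complex.exp (-(z * (h : ℂ)))‖ ≤ 2 * max 1 ‖z‖ * min 1 h := by
  have h2 : ‖1 - Complex.exp (-(z * (h : ℂ)))‖ ≤ 2 := by
    refine (norm_sub_le _ _).trans ?_
    rw [norm_one, norm_cexp_neg_mul]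
    have : Real.exp (-(z.re * h)) ≤ 1 := Real.exp_le_one_iff.2 (by nlinarith)
    linarith
  have hm := le_max_left 1 ‖z‖
  rcases le_total 1 h with h3 | h3
  · rw [min_eq_left h3]
    linarith
  · rw [min_eq_right h3]
    have h5 := mul_le_mul_of_nonneg_right (le_max_right 1 ‖z‖) hh
    rcases le_total ‖-(z * (h : ℂ))‖ 1 with h4 | h4
    · have := Complex.norm_exp_sub_one_le h4
      rw [norm_sub_rev] at this
      rw [norm_neg, norm_mul, Complex.norm_real, Real.norm_of_nonneg hh] at this
      linarith
    · rw [norm_neg, norm_mul, Complex.norm_real, Real.norm_of_nonneg hh] at h4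
      linarith

lemma mul_exp_neg_le {a h : ℝ} (ha : 0 < a) : h * Real.exp (-(a * h)) ≤
    a⁻¹ * (1 - Real.exp (-(a * h))) := by
  have h1 := Real.add_one_le_exp (a * h)
  have h2 : (a * h) * Real.exp (-(a * h)) ≤ 1 - Real.exp (-(a * h)) := by
    have := mul_le_mul_of_nonneg_right h1 (Real.exp_pos (-(a * h))).le
    rw [← Real.exp_add, add_neg_cancel, Real.exp_zero] at this
    linarith
  have := mul_le_mul_of_nonneg_left h2 (inv_pos.2 ha).le
  calc h * Real.exp (-(a * h)) = a⁻¹ * ((a * h) * Real.exp (-(a * h))) := by field_simp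
    _ ≤ _ := this

lemma expNeg_ofReal_mul_coe {a : ℝ} (ha : 0 ≤ a) (h : ℝ≥0) :
    expNeg (ENNReal.ofReal a * h) = ENNReal.ofReal (Real.exp (-(a * h))) := by
  rw [expNeg_of_ne_top (by finiteness), ENNReal.toReal_mul, ENNReal.toReal_ofReal ha]
  simp

lemma one_sub_expNeg_ofReal_mul_coe {a : ℝ} (ha : 0 ≤ a) (h : ℝ≥0) :
    1 - expNeg (ENNReal.ofReal a * h) = ENNReal.ofReal (1 - Real.exp (-(a * h))) := by
  rw [expNeg_ofReal_mul_coe ha, ENNReal.ofReal_sub _ (Real.exp_pos _).le, ENNReal.ofReal_one]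

lemma one_sub_exp_nonneg {a : ℝ} (ha : 0 ≤ a) (h : ℝ≥0) : 0 ≤ 1 - Real.exp (-(a * h)) := by
  have : Real.exp (-(a * h)) ≤ 1 :=
    Real.exp_le_one_iff.2 (by have := mul_nonneg ha h.coe_nonneg; linarith)
  linarith

end Bounds

/-! ### Derivatives of Laplace transforms -/

section ExpMoment

variable {α : Type*} [MeasurableSpace α] {μ : Measure α} {Y : α → ℝ}

/-- The `k`-th derivative `∫ (-Y) ^ k exp (-z Y)` of the Laplace transform of `Y`. -/
noncomputable def expMoment (μ : Measure α) (Y : α → ℝ) (k : ℕ) (z : ℂ) : ℂ :=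
  ∫ a, (-(Y a : ℂ)) ^ k * Complex.exp (-(z * (Y a : ℂ))) ∂μ

/-- Brings in analyticity and differentiation under the integral from the theory of `complexMGF`. -/
lemma expMoment_zero_eq_complexMGF : expMoment μ Y 0 = complexMGF (fun a => -Y a) μ := by
  ext z
  simp [expMoment, complexMGF]

lemma iteratedDeriv_expMoment {z : ℂ} (hz : z.re ∈ interior (integrableExpSet (fun a => -Y a) μ))
    (k : ℕ) : iteratedDeriv k (expMoment μ Y 0) z = expMoment μ Y k z := by
  rw [expMoment_zero_eq_complexMGF, iteratedDeriv_complexMGF hz]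
  simp [expMoment]

lemma integrable_expMoment {z : ℂ} (hz : z.re ∈ interior (integrableExpSet (fun a => -Y a) μ))
    (k : ℕ) : Integrable (fun a => (-(Y a : ℂ)) ^ k * Complex.exp (-(z * (Y a : ℂ)))) μ := by
  simpa using integrable_pow_mul_cexp_of_re_mem_interior_integrableExpSet hz k

lemma analyticAt_expMoment {z : ℂ} (hz : z.re ∈ interior (integrableExpSet (fun a => -Y a) μ)) :
    AnalyticAt ℂ (expMoment μ Y 0) z := by
  rw [expMoment_zero_eq_complexMGF]
  exact analyticAt_complexMGF hz

lemma mem_interior_integrableExpSet_neg [IsFiniteMeasure μ] (hY : Measurable Y) (hY0 : ∀ a, 0 ≤ Y a)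
    {t : ℝ} (ht : 0 < t) : t ∈ interior (integrableExpSet (fun a => -Y a) μ) := by
  refine interior_maximal (t := Set.Ioi 0) ?_ isOpen_Ioi ht
  intro s hs
  refine Integrable.of_bound (C := 1) (by fun_prop) (Eventually.of_forall fun a => ?_)
  rw [Real.norm_of_nonneg (Real.exp_pos _).le]
  refine Real.exp_le_one_iff.2 ?_
  have := mul_nonneg (le_of_lt (Set.mem_Ioi.1 hs)) (hY0 a)
  linarith

lemma norm_pow_mul_cexp (k : ℕ) (z : ℂ) {y : ℝ} (hy : 0 ≤ y) :
    ‖(-(y : ℂ)) ^ k * Complex.exp (-(z * (y : ℂ)))‖ = y ^ k * Real.exp (-(z.re * y)) := by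
  rw [norm_mul, norm_pow, norm_neg, Complex.norm_real, Real.norm_of_nonneg hy, norm_cexp_neg_mul]

end ExpMoment

/-! ### The Laplace exponent and the size-biased measure -/

section Levy

variable {ν : Measure ℝ≥0}

lemma integrable_one_sub_cexp (hν : Integrable (fun h : ℝ≥0 => min 1 (h : ℝ)) ν) {z : ℂ}
    (hz : 0 ≤ z.re) : Integrable (fun h : ℝ≥0 => 1 - Complex.exp (-(z * ((h : ℝ) : ℂ)))) ν := by
  refine (hν.const_mul (2 * max 1 ‖z‖)).mono' (by fun_prop) (Eventually.of_forall fun h => ?_)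
  exact norm_one_sub_cexp_le hz h.coe_nonneg

lemma integrable_one_sub_exp (hν : Integrable (fun h : ℝ≥0 => min 1 (h : ℝ)) ν) {a : ℝ}
    (ha : 0 ≤ a) : Integrable (fun h : ℝ≥0 => 1 - Real.exp (-(a * h))) ν := by
  refine (hν.const_mul (max 1 a)).mono' (by fun_prop) (Eventually.of_forall fun h => ?_)
  rw [Real.norm_of_nonneg (one_sub_exp_nonneg ha h)]
  exact one_sub_exp_le_mul_min_one h.coe_nonneg

lemma lintegral_one_sub_expNeg (hν : Integrable (fun h : ℝ≥0 => min 1 (h : ℝ)) ν) {a : ℝ}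
    (ha : 0 ≤ a) : ∫⁻ h : ℝ≥0, (1 - expNeg (ENNReal.ofReal a * h)) ∂ν =
      ENNReal.ofReal (∫ h : ℝ≥0, (1 - Real.exp (-(a * h))) ∂ν) := by
  simp only [one_sub_expNeg_ofReal_mul_coe ha]
  rw [ofReal_integral_eq_lintegral_ofReal (integrable_one_sub_exp hν ha)
    (Eventually.of_forall (one_sub_exp_nonneg ha))]

/-- A measure for which the Laplace exponent is finite at one point integrates `min 1 h`. -/
lemma integrable_min_one_of_lintegral_ne_top {a : ℝ} (ha : 0 < a)
    (h : ∫⁻ h : ℝ≥0, (1 - expNeg (ENNReal.ofReal a * h)) ∂ν ≠ ∞) :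
    Integrable (fun h : ℝ≥0 => min 1 (h : ℝ)) ν := by
  simp only [one_sub_expNeg_ofReal_mul_coe ha.le] at h
  have h1 : Integrable (fun h : ℝ≥0 => 1 - Real.exp (-(a * h))) ν := by
    refine ⟨by fun_prop, ?_⟩
    rw [hasFiniteIntegral_iff_ofReal (Eventually.of_forall (one_sub_exp_nonneg ha.le))]
    exact h.lt_top
  refine (h1.const_mul ((1 + a) / a)).mono' (by fun_prop) (Eventually.of_forall fun x => ?_)
  rw [Real.norm_of_nonneg (le_min zero_le_one x.coe_nonneg)]
  exact min_one_le_mul_one_sub_exp ha x.coe_nonneg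

lemma integrable_mul_exp_neg (hν : Integrable (fun h : ℝ≥0 => min 1 (h : ℝ)) ν) {a : ℝ}
    (ha : 0 < a) : Integrable (fun h : ℝ≥0 => (h : ℝ) * Real.exp (-(a * h))) ν := by
  refine ((integrable_one_sub_exp hν ha.le).const_mul a⁻¹).mono' (by fun_prop)
    (Eventually.of_forall fun h => ?_)
  rw [Real.norm_of_nonneg (by positivity)]
  exact mul_exp_neg_le ha

/-- The measure with density `h` with respect to `ν`. -/
noncomputable def sizeBias (ν : Measure ℝ≥0) : Measure ℝ≥0 := ν.withDensity fun h => (h : ℝ≥0∞)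

/-- ν may have infinite mass near 0, so its own transform can diverge. The weight h repairs this: h
exp(-sh) ≤ (1 - exp(-sh))/s. The moments of ν of order at least 1 are therefore treated as
derivatives of the transform of `sizeBias ν`. -/
lemma mem_interior_integrableExpSet_sizeBias
    (hν : Integrable (fun h : ℝ≥0 => min 1 (h : ℝ)) ν) {t : ℝ} (ht : 0 < t) :
    t ∈ interior (integrableExpSet (fun h : ℝ≥0 => -(h : ℝ)) (sizeBias ν)) := by
  refine interior_maximal (t := Set.Ioi 0) ?_ isOpen_Ioi ht
  intro s hs
  have h1 : Integrable (fun h : ℝ≥0 => Real.exp (s * -(h : ℝ))) (sizeBias ν) := by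
    refine (integrable_withDensity_iff_integrable_smul measurable_id).2 ?_
    simpa [NNReal.smul_def] using integrable_mul_exp_neg hν (Set.mem_Ioi.1 hs)
  exact h1

lemma expMoment_succ_eq_sizeBias (k : ℕ) (z : ℂ) :
    expMoment ν (fun h : ℝ≥0 => (h : ℝ)) (k + 1) z =
      -expMoment (sizeBias ν) (fun h : ℝ≥0 => (h : ℝ)) k z := by
  unfold expMoment sizeBias
  rw [integral_withDensity_eq_integral_smul (f := fun h : ℝ≥0 => h) measurable_id, ← integral_neg]
  refine integral_congr_ae (Eventually.of_forall fun h => ?_)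
  simp only [NNReal.smul_def, Complex.real_smul]
  ring

lemma integrable_expMoment_succ (hν : Integrable (fun h : ℝ≥0 => min 1 (h : ℝ)) ν) (k : ℕ) {z : ℂ}
    (hz : 0 < z.re) : Integrable (fun h : ℝ≥0 =>
      (-((h : ℝ) : ℂ)) ^ (k + 1) * Complex.exp (-(z * ((h : ℝ) : ℂ)))) ν := by
  have h1 := integrable_expMoment (mem_interior_integrableExpSet_sizeBias hν hz) k
  have h2 := ((integrable_withDensity_iff_integrable_smul (f := fun h : ℝ≥0 => h)
    measurable_id).1 h1).neg
  refine h2.congr (Eventually.of_forall fun h => ?_)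
  simp only [NNReal.smul_def, Complex.real_smul, Pi.neg_apply]
  ring

/-- The derivative of the Laplace exponent. -/
lemma hasDerivAt_laplaceExponent (hν : Integrable (fun h : ℝ≥0 => min 1 (h : ℝ)) ν) {z : ℂ}
    (hz : 0 < z.re) :
    HasDerivAt (fun z : ℂ => ∫ h : ℝ≥0, (1 - Complex.exp (-(z * ((h : ℝ) : ℂ)))) ∂ν)
      (-expMoment ν (fun h : ℝ≥0 => (h : ℝ)) 1 z) z := by
  -- On this half-plane h exp(-(Re z / 2) h) dominates the derivative uniformly.
  have hs : {w : ℂ | z.re / 2 < w.re} ∈ 𝓝 z :=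
    (isOpen_lt continuous_const Complex.continuous_re).mem_nhds (by simp; linarith)
  have key := (hasDerivAt_integral_of_dominated_loc_of_deriv_le (𝕜 := ℂ) (μ := ν)
    (F := fun (z : ℂ) (h : ℝ≥0) => 1 - Complex.exp (-(z * ((h : ℝ) : ℂ))))
    (F' := fun (z : ℂ) (h : ℝ≥0) => ((h : ℝ) : ℂ) * Complex.exp (-(z * ((h : ℝ) : ℂ))))
    (bound := fun h : ℝ≥0 => (h : ℝ) * Real.exp (-(z.re / 2 * h))) hs
    (Eventually.of_forall fun w => by fun_prop) (integrable_one_sub_cexp hν hz.le)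
    (by fun_prop) ?_ (integrable_mul_exp_neg hν (by linarith)) ?_).2
  · have e : -expMoment ν (fun h : ℝ≥0 => (h : ℝ)) 1 z =
        ∫ h : ℝ≥0, ((h : ℝ) : ℂ) * Complex.exp (-(z * ((h : ℝ) : ℂ))) ∂ν := by
      unfold expMoment
      rw [← integral_neg]
      refine integral_congr_ae (Eventually.of_forall fun h => ?_)
      simp
    rw [e]
    exact key
  · refine Eventually.of_forall fun h w hw => ?_
    rw [norm_mul, Complex.norm_real, Real.norm_of_nonneg h.coe_nonneg, norm_cexp_neg_mul]
    refine mul_le_mul_of_nonneg_left (Real.exp_le_exp.2 ?_) h.coe_nonneg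
    exact neg_le_neg (mul_le_mul_of_nonneg_right (le_of_lt hw) h.coe_nonneg)
  · refine Eventually.of_forall fun h w _ => ?_
    have h1 : HasDerivAt (fun w : ℂ => -(w * ((h : ℝ) : ℂ))) (-(1 * ((h : ℝ) : ℂ))) w :=
      ((hasDerivAt_id w).mul_const _).neg
    have h2 := h1.cexp.const_sub 1
    convert h2 using 1
    ring

end Levy

/-! ### The transform of I on the open right half-plane -/

section Exponent

variable {Ω : Type*} [MeasurableSpace Ω] {P : Measure Ω} {I : Ω → ℝ≥0∞} {ν : Measure ℝ≥0}

/-- Since a > 0, the event I = ∞ contributes exp(-∞) = 0 and can be cut off by restricting P. At a =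
0 it would contribute its full probability. -/
lemma lintegral_expNeg_eq [IsProbabilityMeasure P] (hI : Measurable I) {a : ℝ} (ha : 0 < a) :
    ∫⁻ ω, expNeg (ENNReal.ofReal a * I ω) ∂P =
      ENNReal.ofReal (∫ ω, Real.exp (-(a * (I ω).toReal)) ∂(P.restrict {ω | I ω ≠ ∞})) := by
  have hS : MeasurableSet {ω | I ω ≠ ∞} := hI (measurableSet_singleton ∞).compl
  rw [ofReal_integral_eq_lintegral_ofReal, ← lintegral_indicator hS]
  · refine lintegral_congr fun ω => ?_
    by_cases h : I ω = ∞
    · simp [h, ENNReal.mul_top, ha]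
    · rw [Set.indicator_of_mem h, expNeg_of_ne_top (by finiteness), ENNReal.toReal_mul,
        ENNReal.toReal_ofReal ha.le]
  · have hm := hI.ennreal_toReal
    refine Integrable.of_bound (C := 1) (hm.const_mul a).neg.exp.aestronglyMeasurable
      (Eventually.of_forall fun ω => ?_)
    rw [Real.norm_of_nonneg (Real.exp_pos _).le]
    exact Real.exp_le_one_iff.2 (by have : 0 ≤ a * (I ω).toReal := by positivity
                                    linarith)
  · exact Eventually.of_forall fun ω => (Real.exp_pos _).le

/-- `I` has the Laplace transform of a Poisson sum of jumps with Lévy measure `ν`. -/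
def HasLevyLaplace (P : Measure Ω) (I : Ω → ℝ≥0∞) (ν : Measure ℝ≥0) : Prop :=
  ∀ s : ℝ≥0∞, ∫⁻ ω, expNeg (s * I ω) ∂P = expNeg (∫⁻ h : ℝ≥0, (1 - expNeg (s * h)) ∂ν)

/-- If the Laplace exponent is finite, the Laplace transform on the positive half-line. -/
lemma HasLevyLaplace.integral_exp [IsProbabilityMeasure P] (hL : HasLevyLaplace P I ν)
    (hI : Measurable I) (hν : Integrable (fun h : ℝ≥0 => min 1 (h : ℝ)) ν) {a : ℝ} (ha : 0 < a) :
    ∫ ω, Real.exp (-(a * (I ω).toReal)) ∂(P.restrict {ω | I ω ≠ ∞}) =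
      Real.exp (-∫ h : ℝ≥0, (1 - Real.exp (-(a * h))) ∂ν) := by
  have h := hL (ENNReal.ofReal a)
  have hnn : 0 ≤ ∫ h : ℝ≥0, (1 - Real.exp (-(a * h))) ∂ν :=
    integral_nonneg (one_sub_exp_nonneg ha.le)
  rw [lintegral_expNeg_eq hI ha, lintegral_one_sub_expNeg hν ha.le,
    expNeg_of_ne_top ENNReal.ofReal_ne_top, ENNReal.toReal_ofReal hnn,
    ENNReal.ofReal_eq_ofReal_iff (integral_nonneg fun _ => (Real.exp_pos _).le)
      (Real.exp_pos _).le] at h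
  exact h

/-- If the Laplace exponent is infinite, `I` is almost surely infinite. -/
lemma HasLevyLaplace.ae_eq_top (hL : HasLevyLaplace P I ν) (hI : Measurable I)
    (hν : ¬ Integrable (fun h : ℝ≥0 => min 1 (h : ℝ)) ν) : ∀ᵐ ω ∂P, I ω = ∞ := by
  have h := hL (ENNReal.ofReal 1)
  have h1 : ∫⁻ h : ℝ≥0, (1 - expNeg (ENNReal.ofReal 1 * h)) ∂ν = ∞ := by
    by_contra h1
    exact hν (integrable_min_one_of_lintegral_ne_top one_pos h1)
  have hm : Measurable fun ω => expNeg (ENNReal.ofReal 1 * I ω) :=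
    measurable_expNeg.comp (measurable_const.mul hI)
  rw [h1, expNeg_top, lintegral_eq_zero_iff hm] at h
  filter_upwards [h] with ω hω
  simpa [expNeg_eq_zero_iff] using hω

/-- The Laplace transform on the open right half-plane. -/
lemma HasLevyLaplace.expMoment_zero [IsProbabilityMeasure P] (hL : HasLevyLaplace P I ν)
    (hI : Measurable I) (hν : Integrable (fun h : ℝ≥0 => min 1 (h : ℝ)) ν) :
    Set.EqOn (expMoment (P.restrict {ω | I ω ≠ ∞}) (fun ω => (I ω).toReal) 0)
      (fun z : ℂ => Complex.exp (-∫ h : ℝ≥0, (1 - Complex.exp (-(z * ((h : ℝ) : ℂ)))) ∂ν))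
      {z : ℂ | 0 < z.re} := by
  have hU : IsOpen {z : ℂ | 0 < z.re} := isOpen_lt continuous_const Complex.continuous_re
  have hA : AnalyticOnNhd ℂ (expMoment (P.restrict {ω | I ω ≠ ∞}) (fun ω => (I ω).toReal) 0)
      {z : ℂ | 0 < z.re} := fun z hz => analyticAt_expMoment
    (mem_interior_integrableExpSet_neg hI.ennreal_toReal (fun _ => ENNReal.toReal_nonneg) hz)
  have hB : AnalyticOnNhd ℂ (fun z : ℂ =>
      Complex.exp (-∫ h : ℝ≥0, (1 - Complex.exp (-(z * ((h : ℝ) : ℂ)))) ∂ν))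
      {z : ℂ | 0 < z.re} := by
    refine DifferentiableOn.analyticOnNhd (fun z hz => ?_) hU
    exact (hasDerivAt_laplaceExponent hν hz).fun_neg.cexp.differentiableAt.differentiableWithinAt
  -- Identity theorem: both sides agree at the real points 1 + 1/(m+1), which accumulate at 1.
  refine hA.eqOn_of_preconnected_of_frequently_eq hB
    (convex_halfSpace_re_gt 0).isPreconnected (z₀ := 1) (by simp) ?_
  have hlim : Tendsto (fun m : ℕ => ((1 + 1 / ((m : ℝ) + 1) : ℝ) : ℂ)) atTop (𝓝[≠] 1) := by
    refine tendsto_nhdsWithin_iff.2 ⟨?_, Eventually.of_forall fun m => ?_⟩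
    · have := (tendsto_one_div_add_atTop_nhds_zero_nat (𝕜 := ℝ)).const_add 1
      rw [add_zero] at this
      exact (Complex.continuous_ofReal.tendsto _).comp this
    · have : (0 : ℝ) < 1 / ((m : ℝ) + 1) := by positivity
      intro h
      have h' : (1 + 1 / ((m : ℝ) + 1) : ℝ) = 1 := Complex.ofReal_injective (by simpa using h)
      linarith
  refine hlim.frequently (Frequently.of_forall fun m => ?_)
  set a : ℝ := 1 + 1 / ((m : ℝ) + 1) with ha
  have ha0 : 0 < a := by positivity
  have h := congrArg (fun r : ℝ => (r : ℂ)) (hL.integral_exp hI hν ha0)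
  simp only [Complex.ofReal_exp, Complex.ofReal_neg] at h
  rw [← integral_complex_ofReal, ← integral_complex_ofReal] at h
  simpa [expMoment] using h

/-- The derivatives of the Laplace transform satisfy the recursion for the derivatives of
`exp (-ψ)`, where `ψ` is the Laplace exponent. -/
lemma HasLevyLaplace.expMoment_succ [IsProbabilityMeasure P] (hL : HasLevyLaplace P I ν)
    (hI : Measurable I) (hν : Integrable (fun h : ℝ≥0 => min 1 (h : ℝ)) ν) (k : ℕ) {z : ℂ}
    (hz : 0 < z.re) :
    expMoment (P.restrict {ω | I ω ≠ ∞}) (fun ω => (I ω).toReal) (k + 1) z =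
      ∑ i ∈ Finset.range (k + 1), (k.choose i : ℂ) *
        expMoment (P.restrict {ω | I ω ≠ ∞}) (fun ω => (I ω).toReal) i z *
        expMoment ν (fun h : ℝ≥0 => (h : ℝ)) (k - i + 1) z := by
  set Q := P.restrict {ω | I ω ≠ ∞} with hQ
  have hU : IsOpen {z : ℂ | 0 < z.re} := isOpen_lt continuous_const Complex.continuous_re
  have hQi : ∀ {z : ℂ}, 0 < z.re →
      z.re ∈ interior (integrableExpSet (fun ω => -(I ω).toReal) Q) := fun hz =>
    mem_interior_integrableExpSet_neg hI.ennreal_toReal (fun _ => ENNReal.toReal_nonneg) hz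
  -- This is φ' = -φ ψ', with ψ' the transform of the size-biased measure. The Leibniz rule for the
  -- k-th derivative of the product gives the recursion.
  have hderiv : ∀ w : ℂ, 0 < w.re → deriv (expMoment Q (fun ω => (I ω).toReal) 0) w =
      -(expMoment Q (fun ω => (I ω).toReal) 0 w *
        expMoment (sizeBias ν) (fun h : ℝ≥0 => (h : ℝ)) 0 w) := by
    intro w hw
    have h1 : expMoment Q (fun ω => (I ω).toReal) 0 =ᶠ[𝓝 w] (fun z : ℂ =>
        Complex.exp (-∫ h : ℝ≥0, (1 - Complex.exp (-(z * ((h : ℝ) : ℂ)))) ∂ν)) :=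
      (hL.expMoment_zero hI hν).eventuallyEq_of_mem (hU.mem_nhds hw)
    rw [h1.deriv_eq, (hasDerivAt_laplaceExponent hν hw).fun_neg.cexp.deriv, h1.eq_of_nhds, neg_neg,
      expMoment_succ_eq_sizeBias, mul_neg]
  have h2 : deriv (expMoment Q (fun ω => (I ω).toReal) 0) =ᶠ[𝓝 z]
      -(expMoment Q (fun ω => (I ω).toReal) 0 *
        expMoment (sizeBias ν) (fun h : ℝ≥0 => (h : ℝ)) 0) := by
    filter_upwards [hU.mem_nhds hz] with w hw using hderiv w hw
  rw [← iteratedDeriv_expMoment (hQi hz), iteratedDeriv_succ', h2.iteratedDeriv_eq,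
    iteratedDeriv_neg, iteratedDeriv_mul (analyticAt_expMoment (hQi hz)).contDiffAt
      (analyticAt_expMoment (mem_interior_integrableExpSet_sizeBias hν hz)).contDiffAt,
    ← Finset.sum_neg_distrib]
  refine Finset.sum_congr rfl fun i _ => ?_
  rw [iteratedDeriv_expMoment (hQi hz),
    iteratedDeriv_expMoment (mem_interior_integrableExpSet_sizeBias hν hz),
    expMoment_succ_eq_sizeBias, mul_neg]

end Exponent

/-! ### Damped moments and limits at the imaginary axis -/

section Limits

variable {α : Type*} [MeasurableSpace α] {μ : Measure α} {Y : α → ℝ}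

lemma expMoment_ofReal (k : ℕ) (a : ℝ) : expMoment μ Y k (a : ℂ) =
    (-1) ^ k * ((∫ x, Y x ^ k * Real.exp (-(a * Y x)) ∂μ : ℝ) : ℂ) := by
  rw [← integral_complex_ofReal, ← integral_const_mul, expMoment]
  refine integral_congr_ae (Eventually.of_forall fun x => ?_)
  simp only
  push_cast
  rw [neg_pow]
  ring

lemma integrable_pow_mul_exp_of_integrable_pow (hY : Measurable Y) (hY0 : ∀ x, 0 ≤ Y x) {k : ℕ}
    (hk : Integrable (fun x => Y x ^ k) μ) {a : ℝ} (ha : 0 ≤ a) :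
    Integrable (fun x => Y x ^ k * Real.exp (-(a * Y x))) μ := by
  refine hk.mono' (by fun_prop) (Eventually.of_forall fun x => ?_)
  have h0 := pow_nonneg (hY0 x) k
  rw [Real.norm_of_nonneg (by positivity)]
  refine mul_le_of_le_one_right h0 (Real.exp_le_one_iff.2 ?_)
  linarith [mul_nonneg ha (hY0 x)]

lemma integral_pow_mul_exp_le (hY : Measurable Y) (hY0 : ∀ x, 0 ≤ Y x) {k : ℕ}
    (hk : Integrable (fun x => Y x ^ k) μ) {a : ℝ} (ha : 0 ≤ a) :
    ∫ x, Y x ^ k * Real.exp (-(a * Y x)) ∂μ ≤ ∫ x, Y x ^ k ∂μ := by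
  refine integral_mono (integrable_pow_mul_exp_of_integrable_pow hY hY0 hk ha) hk fun x => ?_
  refine mul_le_of_le_one_right (pow_nonneg (hY0 x) k) (Real.exp_le_one_iff.2 ?_)
  linarith [mul_nonneg ha (hY0 x)]

lemma integral_pow_mul_exp_nonneg (hY0 : ∀ x, 0 ≤ Y x) (k : ℕ) (a : ℝ) :
    0 ≤ ∫ x, Y x ^ k * Real.exp (-(a * Y x)) ∂μ :=
  integral_nonneg fun x => mul_nonneg (pow_nonneg (hY0 x) k) (Real.exp_pos _).le

/-- A moment is finite if the exponentially damped moments stay bounded. -/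
lemma integrable_pow_of_forall_le (hY : Measurable Y) (hY0 : ∀ x, 0 ≤ Y x) {k : ℕ} {C : ℝ}
    (hint : ∀ a : ℝ, 0 < a → Integrable (fun x => Y x ^ k * Real.exp (-(a * Y x))) μ)
    (hC : ∀ a : ℝ, 0 < a → a ≤ 1 → ∫ x, Y x ^ k * Real.exp (-(a * Y x)) ∂μ ≤ C) :
    Integrable (fun x => Y x ^ k) μ := by
  refine ⟨by fun_prop, ?_⟩
  rw [hasFiniteIntegral_iff_ofReal (Eventually.of_forall fun x => pow_nonneg (hY0 x) k)]
  -- Monotone convergence along the damping a = 1/(m+1) ≤ 1.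
  have hlim : Tendsto (fun m : ℕ => ∫⁻ x, ENNReal.ofReal
      (Y x ^ k * Real.exp (-(1 / ((m : ℝ) + 1) * Y x))) ∂μ) atTop
      (𝓝 (∫⁻ x, ENNReal.ofReal (Y x ^ k) ∂μ)) := by
    refine lintegral_tendsto_of_tendsto_of_monotone (fun m => by fun_prop)
      (Eventually.of_forall fun x m m' h => ?_) (Eventually.of_forall fun x => ?_)
    · refine ENNReal.ofReal_le_ofReal (mul_le_mul_of_nonneg_left (Real.exp_le_exp.2 ?_)
        (pow_nonneg (hY0 x) k))
      exact neg_le_neg (mul_le_mul_of_nonneg_right (Nat.one_div_le_one_div h) (hY0 x))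
    · refine (ENNReal.continuous_ofReal.tendsto _).comp ?_
      have h1 := (tendsto_one_div_add_atTop_nhds_zero_nat (𝕜 := ℝ)).mul_const (Y x)
      have h2 := ((Real.continuous_exp.tendsto _).comp h1.neg).const_mul (Y x ^ k)
      simpa using h2
  refine lt_of_le_of_lt (le_of_tendsto' hlim fun m => ?_) (ENNReal.ofReal_lt_top (r := C))
  have hm : (0 : ℝ) < 1 / ((m : ℝ) + 1) := by positivity
  rw [← ofReal_integral_eq_lintegral_ofReal (hint _ hm)
    (Eventually.of_forall fun x => mul_nonneg (pow_nonneg (hY0 x) k) (Real.exp_pos _).le)]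
  refine ENNReal.ofReal_le_ofReal (hC _ hm ?_)
  rw [div_le_one (by positivity)]
  linarith [(Nat.cast_nonneg m : (0 : ℝ) ≤ m)]

lemma integrable_pow_mul_cexp (hY : Measurable Y) (hY0 : ∀ x, 0 ≤ Y x) {k : ℕ}
    (hk : Integrable (fun x => Y x ^ k) μ) {z : ℂ} (hz : 0 ≤ z.re) :
    Integrable (fun x => (-(Y x : ℂ)) ^ k * Complex.exp (-(z * (Y x : ℂ)))) μ := by
  refine (integrable_pow_mul_exp_of_integrable_pow hY hY0 hk hz).mono' (by fun_prop)
    (Eventually.of_forall fun x => ?_)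
  rw [norm_pow_mul_cexp k z (hY0 x)]

lemma tendsto_add_one_div (z : ℂ) :
    Tendsto (fun m : ℕ => z + ((1 / ((m : ℝ) + 1) : ℝ) : ℂ)) atTop (𝓝 z) := by
  have h := ((Complex.continuous_ofReal.tendsto _).comp
    (tendsto_one_div_add_atTop_nhds_zero_nat (𝕜 := ℝ))).const_add z
  simpa using h

/-- Y^k dominates the integrand on the whole closed right half-plane. -/
lemma tendsto_expMoment (hY : Measurable Y) (hY0 : ∀ x, 0 ≤ Y x) {k : ℕ}
    (hk : Integrable (fun x => Y x ^ k) μ) {z : ℂ} (hz : 0 ≤ z.re) :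
    Tendsto (fun m : ℕ => expMoment μ Y k (z + ((1 / ((m : ℝ) + 1) : ℝ) : ℂ))) atTop
      (𝓝 (expMoment μ Y k z)) := by
  refine tendsto_integral_of_dominated_convergence (fun x => Y x ^ k) (fun m => by fun_prop) hk
    (fun m => Eventually.of_forall fun x => ?_) (Eventually.of_forall fun x => ?_)
  · rw [norm_pow_mul_cexp k _ (hY0 x)]
    refine mul_le_of_le_one_right (pow_nonneg (hY0 x) k) (Real.exp_le_one_iff.2 ?_)
    have h1 : 0 ≤ (z + ((1 / ((m : ℝ) + 1) : ℝ) : ℂ)).re := by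
      rw [Complex.add_re, Complex.ofReal_re]
      positivity
    linarith [mul_nonneg h1 (hY0 x)]
  · exact ((Complex.continuous_exp.tendsto _).comp
      ((tendsto_add_one_div z).mul_const (Y x : ℂ)).neg).const_mul _

end Limits

/-! ### Moments of I and ν, and the recursion on the closed half-plane -/

section Boundary

variable {Ω : Type*} [MeasurableSpace Ω] {P : Measure Ω} {I : Ω → ℝ≥0∞} {ν : Measure ℝ≥0}

/-- As i + (k - i + 1) = k + 1, every term carries the sign (-1)^(k+1). Once it is cancelled all
terms are nonnegative, so bounds can be read in both directions. -/
lemma HasLevyLaplace.integral_pow_succ [IsProbabilityMeasure P] (hL : HasLevyLaplace P I ν)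
    (hI : Measurable I) (hν : Integrable (fun h : ℝ≥0 => min 1 (h : ℝ)) ν) (k : ℕ) {a : ℝ}
    (ha : 0 < a) :
    ∫ ω, (I ω).toReal ^ (k + 1) * Real.exp (-(a * (I ω).toReal)) ∂(P.restrict {ω | I ω ≠ ∞}) =
      ∑ i ∈ Finset.range (k + 1), (k.choose i : ℝ) *
        (∫ ω, (I ω).toReal ^ i * Real.exp (-(a * (I ω).toReal)) ∂(P.restrict {ω | I ω ≠ ∞})) *
        ∫ h : ℝ≥0, (h : ℝ) ^ (k - i + 1) * Real.exp (-(a * h)) ∂ν := by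
  have h := hL.expMoment_succ hI hν k (z := (a : ℂ)) (by simpa using ha)
  simp only [expMoment_ofReal] at h
  have h1 : ((-1 : ℂ)) ^ (k + 1) ≠ 0 := pow_ne_zero _ (by norm_num)
  have h2 : ∀ i ∈ Finset.range (k + 1), ∀ c x y : ℂ,
      c * ((-1) ^ i * x) * ((-1) ^ (k - i + 1) * y) = (-1) ^ (k + 1) * (c * x * y) := by
    intro i hi c x y
    have : k + 1 = i + (k - i + 1) := by
      have := Finset.mem_range.1 hi
      omega
    rw [this, pow_add (-1 : ℂ) i]
    ring
  rw [Finset.sum_congr rfl fun i hi => h2 i hi _ _ _, ← Finset.mul_sum] at h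
  have h3 := mul_left_cancel₀ h1 h
  exact_mod_cast h3

lemma integrable_laplace_moment [IsFiniteMeasure P] (hI : Measurable I) (k : ℕ) {a : ℝ}
    (ha : 0 < a) : Integrable (fun ω => (I ω).toReal ^ k * Real.exp (-(a * (I ω).toReal)))
      (P.restrict {ω | I ω ≠ ∞}) := by
  have h := (integrable_expMoment (μ := P.restrict {ω | I ω ≠ ∞}) (z := (a : ℂ))
    (mem_interior_integrableExpSet_neg hI.ennreal_toReal (fun ω => ENNReal.toReal_nonneg)
      (by simpa using ha)) k).norm
  refine h.congr (Eventually.of_forall fun ω => ?_)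
  simp only [norm_pow_mul_cexp _ _ ENNReal.toReal_nonneg, Complex.ofReal_re]

/-- Moments of the Lévy measure of orders `1, …, n` bound the moments of `I` up to order `n`. -/
lemma HasLevyLaplace.integrable_pow [IsProbabilityMeasure P] (hL : HasLevyLaplace P I ν)
    (hI : Measurable I) (hν : Integrable (fun h : ℝ≥0 => min 1 (h : ℝ)) ν) {n : ℕ}
    (hmom : ∀ j, 1 ≤ j → j ≤ n → Integrable (fun h : ℝ≥0 => (h : ℝ) ^ j) ν) {k : ℕ} (hk : k ≤ n) :
    Integrable (fun ω => (I ω).toReal ^ k) (P.restrict {ω | I ω ≠ ∞}) := by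
  have hm := hI.ennreal_toReal
  -- The bound must be uniform in a. In the recursion for order k + 1 the moments of I have order at
  -- most k, and those of ν have order between 1 and k + 1.
  have hbound : ∀ k ≤ n, ∃ C : ℝ, ∀ a : ℝ, 0 < a →
      ∫ ω, (I ω).toReal ^ k * Real.exp (-(a * (I ω).toReal)) ∂(P.restrict {ω | I ω ≠ ∞}) ≤ C := by
    intro k
    induction k using Nat.strong_induction_on with
    | _ k ih =>
      intro hk
      rcases k with _ | k
      · refine ⟨∫ ω, (I ω).toReal ^ 0 ∂(P.restrict {ω | I ω ≠ ∞}), fun a ha => ?_⟩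
        exact integral_pow_mul_exp_le hm (fun _ => ENNReal.toReal_nonneg) (by simp) ha.le
      · have hC : ∀ i ∈ Finset.range (k + 1), ∃ C : ℝ, ∀ a : ℝ, 0 < a →
            (k.choose i : ℝ) * (∫ ω, (I ω).toReal ^ i * Real.exp (-(a * (I ω).toReal))
              ∂(P.restrict {ω | I ω ≠ ∞})) *
            ∫ h : ℝ≥0, (h : ℝ) ^ (k - i + 1) * Real.exp (-(a * h)) ∂ν ≤ C := by
          intro i hi
          have hi' := Finset.mem_range.1 hi
          obtain ⟨C, hC⟩ := ih i hi' (by omega)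
          refine ⟨(k.choose i : ℝ) * C * ∫ h : ℝ≥0, (h : ℝ) ^ (k - i + 1) ∂ν, fun a ha => ?_⟩
          have h1 := integral_pow_mul_exp_le (μ := ν) (Y := fun h : ℝ≥0 => (h : ℝ)) (by fun_prop)
            (fun h => h.coe_nonneg) (hmom (k - i + 1) (by omega) (by omega)) ha.le
          have h2 := integral_pow_mul_exp_nonneg (μ := ν) (Y := fun h : ℝ≥0 => (h : ℝ))
            (fun h => h.coe_nonneg) (k - i + 1) a
          have h3 := integral_pow_mul_exp_nonneg (μ := P.restrict {ω | I ω ≠ ∞})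
            (Y := fun ω => (I ω).toReal) (fun ω => ENNReal.toReal_nonneg) i a
          exact mul_le_mul (mul_le_mul_of_nonneg_left (hC a ha) (Nat.cast_nonneg _)) h1 h2
            (mul_nonneg (Nat.cast_nonneg _) (h3.trans (hC a ha)))
        choose! C hC using hC
        refine ⟨∑ i ∈ Finset.range (k + 1), C i, fun a ha => ?_⟩
        rw [hL.integral_pow_succ hI hν k ha]
        exact Finset.sum_le_sum fun i hi => hC i hi a ha
  obtain ⟨C, hC⟩ := hbound k hk
  exact integrable_pow_of_forall_le hm (fun _ => ENNReal.toReal_nonneg)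
    (fun a ha => integrable_laplace_moment hI k ha) fun a ha _ => hC a ha

/-- A moment of `I` of positive order bounds the same moment of the Lévy measure. -/
lemma HasLevyLaplace.integrable_pow_levy [IsProbabilityMeasure P] (hL : HasLevyLaplace P I ν)
    (hI : Measurable I) (hν : Integrable (fun h : ℝ≥0 => min 1 (h : ℝ)) ν) {k : ℕ}
    (hk : Integrable (fun ω => (I ω).toReal ^ (k + 1)) (P.restrict {ω | I ω ≠ ∞})) :
    Integrable (fun h : ℝ≥0 => (h : ℝ) ^ (k + 1)) ν := by
  have hm := hI.ennreal_toReal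
  -- c is the transform of I at 1, a positive lower bound for the transform at every a ≤ 1.
  set c : ℝ := Real.exp (-∫ h : ℝ≥0, (1 - Real.exp (-(1 * h))) ∂ν) with hc
  have hc0 : 0 < c := Real.exp_pos _
  refine integrable_pow_of_forall_le (Y := fun h : ℝ≥0 => (h : ℝ))
    (C := (∫ ω, (I ω).toReal ^ (k + 1) ∂(P.restrict {ω | I ω ≠ ∞})) / c)
    (by fun_prop) (fun h => h.coe_nonneg) (fun a ha => ?_) fun a ha ha1 => ?_
  · have h := (integrable_expMoment_succ hν k (z := (a : ℂ)) (by simpa using ha)).norm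
    refine h.congr (Eventually.of_forall fun h => ?_)
    simp only [norm_pow_mul_cexp _ _ h.coe_nonneg, Complex.ofReal_re]
  · rw [le_div_iff₀ hc0, mul_comm]
    have hQ : ∀ i, 0 ≤ ∫ ω, (I ω).toReal ^ i * Real.exp (-(a * (I ω).toReal))
        ∂(P.restrict {ω | I ω ≠ ∞}) := fun i =>
      integral_pow_mul_exp_nonneg (fun ω => ENNReal.toReal_nonneg) i a
    have hN : ∀ i, 0 ≤ ∫ h : ℝ≥0, (h : ℝ) ^ i * Real.exp (-(a * h)) ∂ν := fun i =>
      integral_pow_mul_exp_nonneg (Y := fun h : ℝ≥0 => (h : ℝ)) (fun h => h.coe_nonneg) i a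
    have h1 : c ≤ ∫ ω, (I ω).toReal ^ 0 * Real.exp (-(a * (I ω).toReal))
        ∂(P.restrict {ω | I ω ≠ ∞}) := by
      simp only [pow_zero, one_mul]
      rw [hL.integral_exp hI hν ha]
      refine Real.exp_le_exp.2 (neg_le_neg ?_)
      refine integral_mono (integrable_one_sub_exp hν ha.le)
        (integrable_one_sub_exp hν zero_le_one) fun h => ?_
      refine sub_le_sub_left (Real.exp_le_exp.2 (neg_le_neg ?_)) _
      exact mul_le_mul_of_nonneg_right ha1 h.coe_nonneg
    have h2 := hL.integral_pow_succ hI hν k ha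
    -- Keeping only i = 0 bounds the transform at a times the damped ν-moment of order k + 1 by the
    -- damped moment of I.
    have h3 := Finset.single_le_sum (f := fun i => (k.choose i : ℝ) *
        (∫ ω, (I ω).toReal ^ i * Real.exp (-(a * (I ω).toReal)) ∂(P.restrict {ω | I ω ≠ ∞})) *
        ∫ h : ℝ≥0, (h : ℝ) ^ (k - i + 1) * Real.exp (-(a * h)) ∂ν)
      (fun i _ => mul_nonneg (mul_nonneg (Nat.cast_nonneg _) (hQ i)) (hN _))
      (Finset.mem_range.2 k.succ_pos)
    rw [← h2] at h3
    simp only [Nat.choose_zero_right, Nat.cast_one, one_mul, Nat.sub_zero] at h3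
    exact (mul_le_mul_of_nonneg_right h1 (hN _)).trans (h3.trans
      (integral_pow_mul_exp_le hm (fun _ => ENNReal.toReal_nonneg) hk ha.le))

lemma tendsto_laplaceExponent (hν : Integrable (fun h : ℝ≥0 => min 1 (h : ℝ)) ν) {z : ℂ}
    (hz : 0 ≤ z.re) :
    Tendsto (fun m : ℕ => ∫ h : ℝ≥0,
      (1 - Complex.exp (-((z + ((1 / ((m : ℝ) + 1) : ℝ) : ℂ)) * ((h : ℝ) : ℂ)))) ∂ν) atTop
      (𝓝 (∫ h : ℝ≥0, (1 - Complex.exp (-(z * ((h : ℝ) : ℂ)))) ∂ν)) := by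
  refine tendsto_integral_of_dominated_convergence
    (fun h : ℝ≥0 => 2 * (1 + ‖z‖) * min 1 (h : ℝ)) (fun m => by fun_prop)
    (hν.const_mul _) (fun m => Eventually.of_forall fun h => ?_) (Eventually.of_forall fun h => ?_)
  · have hm : (0 : ℝ) ≤ 1 / ((m : ℝ) + 1) := by positivity
    have hm1 : 1 / ((m : ℝ) + 1) ≤ 1 := by
      rw [div_le_one (by positivity)]
      linarith [(Nat.cast_nonneg m : (0 : ℝ) ≤ m)]
    refine (norm_one_sub_cexp_le ?_ h.coe_nonneg).trans ?_
    · rw [Complex.add_re, Complex.ofReal_re]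
      linarith
    · refine mul_le_mul_of_nonneg_right (mul_le_mul_of_nonneg_left (max_le ?_ ?_) zero_le_two)
        (le_min zero_le_one h.coe_nonneg)
      · linarith [norm_nonneg z]
      · refine (norm_add_le _ _).trans ?_
        rw [Complex.norm_real, Real.norm_of_nonneg hm]
        linarith
  · exact ((Complex.continuous_exp.tendsto _).comp
      ((tendsto_add_one_div z).mul_const ((h : ℝ) : ℂ)).neg).const_sub 1

/-- If the Laplace exponent is finite, `I` is almost surely finite. -/
lemma HasLevyLaplace.ae_ne_top [IsProbabilityMeasure P] (hL : HasLevyLaplace P I ν)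
    (hI : Measurable I) (hν : Integrable (fun h : ℝ≥0 => min 1 (h : ℝ)) ν) :
    ∀ᵐ ω ∂P, I ω ≠ ∞ := by
  have hS : MeasurableSet {ω | I ω ≠ ∞} := hI (measurableSet_singleton ∞).compl
  -- As z decreases to 0, exp(-ψ(z)) tends to 1, while the transform never exceeds P(I < ∞).
  have h1 := ((Complex.continuous_exp.tendsto _).comp
    (tendsto_laplaceExponent hν (z := 0) le_rfl).neg)
  have h2 : ∀ m : ℕ, ‖expMoment (P.restrict {ω | I ω ≠ ∞}) (fun ω => (I ω).toReal) 0
      (0 + ((1 / ((m : ℝ) + 1) : ℝ) : ℂ))‖ ≤ P.real {ω | I ω ≠ ∞} := by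
    intro m
    have hre : 0 ≤ ((0 : ℂ) + ((1 / ((m : ℝ) + 1) : ℝ) : ℂ)).re := by
      rw [zero_add, Complex.ofReal_re]
      positivity
    refine (norm_integral_le_of_norm_le_const (C := 1) (Eventually.of_forall fun ω => ?_)).trans ?_
    · rw [norm_pow_mul_cexp _ _ ENNReal.toReal_nonneg, pow_zero, one_mul]
      refine Real.exp_le_one_iff.2 ?_
      linarith [mul_nonneg hre (ENNReal.toReal_nonneg (a := I ω))]
    · simp
  have h3 : (1 : ℝ) ≤ P.real {ω | I ω ≠ ∞} := by
    have h4 := h1.norm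
    simp only [zero_mul, neg_zero, Complex.exp_zero, sub_self, integral_zero, norm_one] at h4
    refine le_of_tendsto' h4 fun m => ?_
    have h5 := hL.expMoment_zero hI hν (x := 0 + ((1 / ((m : ℝ) + 1) : ℝ) : ℂ)) (by
      rw [Set.mem_ofPred_eq, zero_add, Complex.ofReal_re]
      positivity)
    have h6 := h2 m
    rw [h5] at h6
    exact h6
  have h7 : P {ω | I ω ≠ ∞} = 1 := by
    refine le_antisymm prob_le_one ?_
    rw [← ENNReal.ofReal_one, ← ofReal_measureReal]
    exact ENNReal.ofReal_le_ofReal h3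
  exact (prob_compl_eq_zero_iff hS).2 h7

/-- The Laplace transform on the closed right half-plane. -/
lemma HasLevyLaplace.expMoment_zero_of_re_nonneg [IsProbabilityMeasure P]
    (hL : HasLevyLaplace P I ν) (hI : Measurable I)
    (hν : Integrable (fun h : ℝ≥0 => min 1 (h : ℝ)) ν) {z : ℂ} (hz : 0 ≤ z.re) :
    expMoment (P.restrict {ω | I ω ≠ ∞}) (fun ω => (I ω).toReal) 0 z =
      Complex.exp (-∫ h : ℝ≥0, (1 - Complex.exp (-(z * ((h : ℝ) : ℂ)))) ∂ν) := by
  refine tendsto_nhds_unique (tendsto_expMoment hI.ennreal_toReal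
    (fun _ => ENNReal.toReal_nonneg) (by simp) hz)
    (((Complex.continuous_exp.tendsto _).comp (tendsto_laplaceExponent hν hz).neg).congr fun m => ?_)
  refine (hL.expMoment_zero hI hν ?_).symm
  rw [Set.mem_ofPred_eq, Complex.add_re, Complex.ofReal_re]
  positivity

/-- The recursion for the derivatives of the Laplace transform, on the closed right half-plane. -/
lemma HasLevyLaplace.expMoment_succ_of_re_nonneg [IsProbabilityMeasure P]
    (hL : HasLevyLaplace P I ν) (hI : Measurable I)
    (hν : Integrable (fun h : ℝ≥0 => min 1 (h : ℝ)) ν) {n : ℕ}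
    (hmom : ∀ j, 1 ≤ j → j ≤ n → Integrable (fun h : ℝ≥0 => (h : ℝ) ^ j) ν) {k : ℕ} (hk : k + 1 ≤ n)
    {z : ℂ} (hz : 0 ≤ z.re) :
    expMoment (P.restrict {ω | I ω ≠ ∞}) (fun ω => (I ω).toReal) (k + 1) z =
      ∑ i ∈ Finset.range (k + 1), (k.choose i : ℂ) *
        expMoment (P.restrict {ω | I ω ≠ ∞}) (fun ω => (I ω).toReal) i z *
        expMoment ν (fun h : ℝ≥0 => (h : ℝ)) (k - i + 1) z := by
  have hQ : ∀ i ≤ n, Tendsto (fun m : ℕ => expMoment (P.restrict {ω | I ω ≠ ∞})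
      (fun ω => (I ω).toReal) i (z + ((1 / ((m : ℝ) + 1) : ℝ) : ℂ))) atTop
      (𝓝 (expMoment (P.restrict {ω | I ω ≠ ∞}) (fun ω => (I ω).toReal) i z)) := fun i hi =>
    tendsto_expMoment hI.ennreal_toReal (fun _ => ENNReal.toReal_nonneg)
      (hL.integrable_pow hI hν hmom hi) hz
  refine tendsto_nhds_unique (hQ (k + 1) hk) ?_
  refine (tendsto_finsetSum (Finset.range (k + 1)) fun i hi => ((hQ i ?_).const_mul
    (k.choose i : ℂ)).mul (tendsto_expMoment (Y := fun h : ℝ≥0 => (h : ℝ)) (by fun_prop)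
      (fun h => h.coe_nonneg) (hmom (k - i + 1) ?_ ?_) hz)).congr fun m => ?_
  · have := Finset.mem_range.1 hi
    omega
  · omega
  · omega
  · refine (hL.expMoment_succ hI hν k ?_).symm
    rw [Complex.add_re, Complex.ofReal_re]
    positivity

end Boundary

/-! ### Disintegration of integrals against `Λ.bind κ` -/

section Kernel

variable {β : Type*} [MeasurableSpace β] {Λ : Measure β} {κ : Kernel β ℝ≥0}

lemma ae_integrable_of_integrable_bind {f : ℝ≥0 → ℂ} (hf : Integrable f (Λ.bind κ)) :
    ∀ᵐ x ∂Λ, Integrable f (κ x) :=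
  ((Measure.integrable_comp_iff hf.1).1 hf).1

lemma integrable_integral_of_integrable_bind {f : ℝ≥0 → ℂ} (hf : Integrable f (Λ.bind κ)) :
    Integrable (fun x => ∫ h, f h ∂κ x) Λ := by
  have h : Integrable f ((κ ∘ₖ Kernel.const Unit Λ) ()) := by
    rwa [← Measure.comp_eq_comp_const_apply]
  simpa using h.integral_comp

lemma integral_bind_eq {f : ℝ≥0 → ℂ} (hf : Integrable f (Λ.bind κ)) :
    ∫ h, f h ∂(Λ.bind κ) = ∫ x, ∫ h, f h ∂κ x ∂Λ := by
  have h : Integrable f ((κ ∘ₖ Kernel.const Unit Λ) ()) := by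
    rwa [← Measure.comp_eq_comp_const_apply]
  have h2 := Kernel.integral_comp h
  rwa [← Measure.comp_eq_comp_const_apply, Kernel.const_apply] at h2

end Kernel

/-! ### The matrix Laplace transform at a Jordan block -/

section Matrix

variable {Ω : Type*} [MeasurableSpace Ω] {P : Measure Ω} {Y : Ω → ℝ≥0∞}

lemma expNegMul_jordanBlock {n : ℕ} (z : ℂ) {t : ℝ≥0∞} (ht : t ≠ ∞) :
    expNegMul (jordanBlock n z) t = toeplitz n (fun k =>
      (-(t.toReal : ℂ)) ^ k * Complex.exp (-(z * (t.toReal : ℂ))) / k.factorial) := by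
  rw [expNegMul, if_neg ht, exp_neg_smul_jordanBlock]
  simp only [mul_neg]

lemma tendsto_exp_neg_smul_jordanBlock {n : ℕ} {z : ℂ} (hz : 0 < z.re) :
    Tendsto (fun r : ℝ => NormedSpace.exp (-((r : ℂ) • jordanBlock n z))) atTop (𝓝 0) := by
  simp only [exp_neg_smul_jordanBlock]
  refine tendsto_pi_nhds.2 fun i => tendsto_pi_nhds.2 fun j => ?_
  by_cases hij : i ≤ j
  · simp only [toeplitz_apply_le _ hij]
    set k : ℕ := (j : ℕ) - i
    refine tendsto_zero_iff_norm_tendsto_zero.2 ?_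
    have h1 := ((Real.tendsto_pow_mul_exp_neg_atTop_nhds_zero k).comp
      (tendsto_id.const_mul_atTop hz)).div_const (z.re ^ k * k.factorial)
    rw [zero_div] at h1
    refine h1.congr' ?_
    filter_upwards [eventually_ge_atTop 0] with r hr
    have hk : (k.factorial : ℝ) ≠ 0 := by exact_mod_cast k.factorial_ne_zero
    rw [norm_div, mul_neg, norm_pow_mul_cexp k z hr, Complex.norm_natCast]
    simp only [Function.comp_apply, id]
    rw [mul_pow]
    field_simp
  · simp only [toeplitz_apply_not_le _ hij]
    exact tendsto_const_nhds

/-- Where Y = ∞ the matrix exponential is the limit 0, so only the restriction to Y < ∞ is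
integrated. The hypothesis `hlim` covers both uses: decay when Re z > 0, and vacuity when Y is a.s.
finite. -/
lemma matrixLaplace_jordanBlock (hY : Measurable Y) {n : ℕ} {z : ℂ}
    (hlim : ∀ᵐ ω ∂P, Y ω = ∞ →
      Tendsto (fun r : ℝ => NormedSpace.exp (-((r : ℂ) • jordanBlock n z))) atTop (𝓝 0))
    (hint : ∀ k < n, Integrable (fun ω => (-((Y ω).toReal : ℂ)) ^ k *
      Complex.exp (-(z * ((Y ω).toReal : ℂ)))) (P.restrict {ω | Y ω ≠ ∞})) :
    MatrixLaplaceExists P Y (jordanBlock n z) ∧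
    matrixLaplace P Y (jordanBlock n z) = toeplitz n (fun k =>
      expMoment (P.restrict {ω | Y ω ≠ ∞}) (fun ω => (Y ω).toReal) k z / k.factorial) := by
  have hS : MeasurableSet {ω | Y ω ≠ ∞} := hY (measurableSet_singleton ∞).compl
  have hae : ∀ i j, (fun ω => expNegMul (jordanBlock n z) (Y ω) i j) =ᵐ[P]
      {ω | Y ω ≠ ∞}.indicator (fun ω => toeplitz n (fun k => (-((Y ω).toReal : ℂ)) ^ k *
        Complex.exp (-(z * ((Y ω).toReal : ℂ))) / k.factorial) i j) := by
    intro i j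
    filter_upwards [hlim] with ω hω
    by_cases h : Y ω = ∞
    · rw [Set.indicator_of_notMem (by simpa using h), expNegMul, if_pos h, (hω h).limUnder_eq]
      rfl
    · rw [Set.indicator_of_mem h, expNegMul_jordanBlock z h]
  refine ⟨⟨hlim.mono fun ω hω h => ⟨0, hω h⟩, fun i j => ?_⟩, ?_⟩
  · rw [integrable_congr (hae i j), integrable_indicator_iff hS]
    by_cases hij : i ≤ j
    · simp only [toeplitz_apply_le _ hij]
      exact (hint _ (by omega)).div_const _
    · simp only [toeplitz_apply_not_le _ hij]
      exact integrable_zero _ _ _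
  · ext i j
    rw [matrixLaplace, Matrix.of_apply, integral_congr_ae (hae i j), integral_indicator hS]
    by_cases hij : i ≤ j
    · simp only [toeplitz_apply_le _ hij, expMoment, integral_div]
    · simp only [toeplitz_apply_not_le _ hij, integral_zero]

end Matrix

/-! ### The formula at a Jordan block and its converse -/

section Campbell

variable {Ω : Type*} [MeasurableSpace Ω] {P : Measure Ω} {I : Ω → ℝ≥0∞}
  {Ω' : Type*} [MeasurableSpace Ω'] {P' : Measure Ω'}
  {d : ℕ} {Λ : Measure (EuclideanSpace ℝ (Fin d))} {H : EuclideanSpace ℝ (Fin d) → Ω' → ℝ≥0}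
  {κ : Kernel (EuclideanSpace ℝ (Fin d)) ℝ≥0}

/-- The recursion for the coefficients of an exponential, from the recursion for derivatives. -/
lemma toeplitz_recursion {A B : ℕ → ℂ} {k : ℕ}
    (h : A (k + 1) = ∑ i ∈ Finset.range (k + 1), (k.choose i : ℂ) * A i * B (k - i + 1)) :
    ((k : ℂ) + 1) * (A (k + 1) / (k + 1).factorial) =
      ∑ p ∈ Finset.HasAntidiagonal.antidiagonal k, A p.1 / p.1.factorial *
        (((p.2 : ℂ) + 1) * (B (p.2 + 1) / (p.2 + 1).factorial)) := by
  have hfac : ∀ m : ℕ, (m.factorial : ℂ) ≠ 0 := fun m => by exact_mod_cast m.factorial_ne_zero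
  have hsucc : ∀ m : ℕ, (m : ℂ) + 1 ≠ 0 := fun m => by exact_mod_cast m.succ_ne_zero
  have hcancel : ∀ (m : ℕ) (x : ℂ), ((m : ℂ) + 1) * (x / (m + 1).factorial) = x / m.factorial := by
    intro m x
    have h1 := hfac m
    have h2 := hsucc m
    rw [Nat.factorial_succ]
    push_cast
    field_simp
  simp only [hcancel]
  rw [h, Finset.Nat.sum_antidiagonal_eq_sum_range_succ_mk, Finset.sum_div]
  refine Finset.sum_congr rfl fun i hi => ?_
  have hi' : i ≤ k := Nat.lt_succ_iff.1 (Finset.mem_range.1 hi)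
  rw [Nat.cast_choose ℂ hi']
  have h1 := hfac k
  have h2 := hfac i
  have h3 := hfac (k - i)
  field_simp

lemma scalarLaplace_eq (hH : ∀ x, Measurable (H x)) {x : EuclideanSpace ℝ (Fin d)}
    (hx : P'.map (H x) = κ x) (z : ℂ) :
    scalarLaplace P' (H x) z = ∫ h : ℝ≥0, Complex.exp (-(z * ((h : ℝ) : ℂ))) ∂κ x := by
  rw [scalarLaplace, ← hx, integral_map (hH x).aemeasurable (by fun_prop)]

lemma integrable_cexp_neg [IsFiniteMeasure P] {Y : Ω → ℝ} (hY : Measurable Y) (hY0 : ∀ ω, 0 ≤ Y ω)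
    {z : ℂ} (hz : 0 ≤ z.re) : Integrable (fun ω => Complex.exp (-(z * (Y ω : ℂ)))) P := by
  simpa using integrable_pow_mul_cexp hY hY0 (k := 0) (μ := P) (by simp) hz

lemma one_sub_scalarLaplace_ae_eq [IsMarkovKernel κ] (hH : ∀ x, Measurable (H x))
    (hκ : ∀ᵐ x ∂Λ, P'.map (H x) = κ x) {z : ℂ} (hz : 0 ≤ z.re) :
    (fun x => 1 - scalarLaplace P' (H x) z) =ᵐ[Λ]
      fun x => ∫ h : ℝ≥0, (1 - Complex.exp (-(z * ((h : ℝ) : ℂ)))) ∂κ x := by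
  filter_upwards [hκ] with x hx
  rw [scalarLaplace_eq hH hx, integral_sub (integrable_const _)
    (integrable_cexp_neg (by fun_prop) (fun h => h.coe_nonneg) hz)]
  simp

lemma integrable_one_sub_scalarLaplace [IsMarkovKernel κ] (hH : ∀ x, Measurable (H x))
    (hκ : ∀ᵐ x ∂Λ, P'.map (H x) = κ x)
    (hν : Integrable (fun h : ℝ≥0 => min 1 (h : ℝ)) (Λ.bind κ)) {z : ℂ} (hz : 0 ≤ z.re) :
    Integrable (fun x => 1 - scalarLaplace P' (H x) z) Λ := by
  rw [integrable_congr (one_sub_scalarLaplace_ae_eq hH hκ hz)]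
  exact integrable_integral_of_integrable_bind (integrable_one_sub_cexp hν hz)

/-- No cancellation can hide divergence: Re(1 - exp(-zh)) ≥ 1 - exp(-(Re z) h) ≥ 0, so integrability
at z implies integrability at Re z. -/
lemma integrable_min_one_of_integrable_one_sub_scalarLaplace [IsMarkovKernel κ]
    (hH : ∀ x, Measurable (H x)) (hκ : ∀ᵐ x ∂Λ, P'.map (H x) = κ x) {z : ℂ} (hz : 0 < z.re)
    (hint : Integrable (fun x => 1 - scalarLaplace P' (H x) z) Λ) :
    Integrable (fun h : ℝ≥0 => min 1 (h : ℝ)) (Λ.bind κ) := by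
  rw [integrable_congr (one_sub_scalarLaplace_ae_eq hH hκ hz.le)] at hint
  refine integrable_min_one_of_lintegral_ne_top hz (ne_of_lt ?_)
  have hm : Measurable fun h : ℝ≥0 => 1 - expNeg (ENNReal.ofReal z.re * h) :=
    measurable_const.sub (measurable_expNeg.comp
      (measurable_const.mul measurable_coe_nnreal_ennreal))
  rw [Measure.lintegral_bind κ.measurable.aemeasurable hm.aemeasurable]
  refine lt_of_le_of_lt (lintegral_mono fun x => ?_) hint.2
  have hreal : Integrable (fun h : ℝ≥0 => 1 - Real.exp (-(z.re * h))) (κ x) := by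
    refine Integrable.of_bound (C := 1) (by fun_prop) (Eventually.of_forall fun h => ?_)
    rw [Real.norm_of_nonneg (one_sub_exp_nonneg hz.le h)]
    linarith [Real.exp_pos (-(z.re * h))]
  have hcplx : Integrable (fun h : ℝ≥0 => 1 - Complex.exp (-(z * ((h : ℝ) : ℂ)))) (κ x) :=
    (integrable_const _).sub (integrable_cexp_neg (by fun_prop) (fun h => h.coe_nonneg) hz.le)
  simp only [one_sub_expNeg_ofReal_mul_coe hz.le]
  rw [← ofReal_integral_eq_lintegral_ofReal hreal
    (Eventually.of_forall (one_sub_exp_nonneg hz.le)), ← ofReal_norm]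
  refine ENNReal.ofReal_le_ofReal (le_trans ?_ (Complex.re_le_norm _))
  rw [← RCLike.re_eq_complex_re, ← integral_re hcplx]
  refine integral_mono hreal hcplx.re fun h => ?_
  have h1 := Complex.re_le_norm (Complex.exp (-(z * ((h : ℝ) : ℂ))))
  rw [norm_cexp_neg_mul] at h1
  simp only [RCLike.re_eq_complex_re, Complex.sub_re, Complex.one_re]
  linarith

/-- The matrix formula at a Jordan block, from the recursion for the Laplace transform. -/
lemma campbellFormula_of_recursion [IsProbabilityMeasure P] [IsProbabilityMeasure P']
    [IsMarkovKernel κ] (hH : ∀ x, Measurable (H x)) (hκ : ∀ᵐ x ∂Λ, P'.map (H x) = κ x)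
    (hI : Measurable I) (hL : HasLevyLaplace P I (Λ.bind κ))
    (hν : Integrable (fun h : ℝ≥0 => min 1 (h : ℝ)) (Λ.bind κ)) {n : ℕ} {z : ℂ} (hz : 0 ≤ z.re)
    (hintI : ∀ k < n, Integrable (fun ω => (-((I ω).toReal : ℂ)) ^ k *
      Complex.exp (-(z * ((I ω).toReal : ℂ)))) (P.restrict {ω | I ω ≠ ∞}))
    (hintν : ∀ k, k + 1 < n → Integrable (fun h : ℝ≥0 => (-((h : ℝ) : ℂ)) ^ (k + 1) *
      Complex.exp (-(z * ((h : ℝ) : ℂ)))) (Λ.bind κ))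
    (hrec : ∀ k, k + 1 < n →
      expMoment (P.restrict {ω | I ω ≠ ∞}) (fun ω => (I ω).toReal) (k + 1) z =
      ∑ i ∈ Finset.range (k + 1), (k.choose i : ℂ) *
        expMoment (P.restrict {ω | I ω ≠ ∞}) (fun ω => (I ω).toReal) i z *
        expMoment (Λ.bind κ) (fun h : ℝ≥0 => (h : ℝ)) (k - i + 1) z) :
    CampbellFormula P I P' H Λ (jordanBlock n z) := by
  -- `F k h` is the k-th Toeplitz coefficient of 1 - exp(-hJ). The 1 has to stay under the integral,
  -- since ν may be infinite.
  set F : ℕ → ℝ≥0 → ℂ := fun k h => (if k = 0 then 1 else 0) -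
    (-((h : ℝ) : ℂ)) ^ k * Complex.exp (-(z * ((h : ℝ) : ℂ))) / k.factorial with hF
  have hF0 : F 0 = fun h : ℝ≥0 => 1 - Complex.exp (-(z * ((h : ℝ) : ℂ))) := by
    ext h
    simp [hF]
  have hFs : ∀ k, F (k + 1) = fun h : ℝ≥0 => -((-((h : ℝ) : ℂ)) ^ (k + 1) *
      Complex.exp (-(z * ((h : ℝ) : ℂ))) / (k + 1).factorial) := by
    intro k
    ext h
    simp [hF]
  have hFint : ∀ k < n, Integrable (F k) (Λ.bind κ) := by
    intro k hk
    rcases k with _ | k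
    · rw [hF0]
      exact integrable_one_sub_cexp hν hz
    · rw [hFs]
      exact ((hintν k hk).div_const _).neg
  have hae : ∀ᵐ x ∂Λ, MatrixLaplaceExists P' (fun ω' => (H x ω' : ℝ≥0∞)) (jordanBlock n z) ∧
      1 - matrixLaplace P' (fun ω' => (H x ω' : ℝ≥0∞)) (jordanBlock n z) =
        toeplitz n (fun k => ∫ h, F k h ∂κ x) := by
    have hall : ∀ᵐ x ∂Λ, ∀ k, k + 1 < n → Integrable (fun h : ℝ≥0 => (-((h : ℝ) : ℂ)) ^ (k + 1) *
        Complex.exp (-(z * ((h : ℝ) : ℂ)))) (κ x) := by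
      refine ae_all_iff.2 fun k => ?_
      by_cases hk : k + 1 < n
      · filter_upwards [ae_integrable_of_integrable_bind (hintν k hk)] with x hx _ using hx
      · exact Eventually.of_forall fun x h => absurd h hk
    filter_upwards [hκ, hall] with x hx hxall
    have hint : ∀ k < n, Integrable (fun h : ℝ≥0 => (-((h : ℝ) : ℂ)) ^ k *
        Complex.exp (-(z * ((h : ℝ) : ℂ)))) (κ x) := by
      intro k hk
      rcases k with _ | k
      · simpa using integrable_cexp_neg (P := κ x) (Y := fun h : ℝ≥0 => (h : ℝ)) (by fun_prop)
          (fun h => h.coe_nonneg) hz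
      · exact hxall k hk
    have hres : P'.restrict {ω' | (H x ω' : ℝ≥0∞) ≠ ∞} = P' := by simp
    have hHx := (hH x).aemeasurable (μ := P')
    have h1 := matrixLaplace_jordanBlock (P := P') (Y := fun ω' => (H x ω' : ℝ≥0∞)) (n := n)
      (z := z) (hH x).coe_nnreal_ennreal (Eventually.of_forall fun ω' h => by simp at h) (by
        intro k hk
        rw [hres]
        have h2 := hint k hk
        rw [← hx] at h2
        exact h2.comp_aemeasurable hHx)
    refine ⟨h1.1, ?_⟩
    rw [h1.2, hres]
    have hmom : ∀ k, expMoment P' (fun ω' => ((H x ω' : ℝ≥0∞)).toReal) k z =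
        expMoment (κ x) (fun h : ℝ≥0 => (h : ℝ)) k z := by
      intro k
      unfold expMoment
      rw [← hx, integral_map hHx (by fun_prop)]
      simp
    have hFx : ∀ k < n, ∫ h, F k h ∂κ x = (if k = 0 then 1 else 0) -
        expMoment (κ x) (fun h : ℝ≥0 => (h : ℝ)) k z / k.factorial := by
      intro k hk
      rw [hF]
      simp only
      rw [integral_sub (integrable_const _) ((hint k hk).div_const _), integral_div]
      simp [expMoment]
    simp only [hmom]
    rw [toeplitz_congr hFx]
    ext i j
    rw [Matrix.sub_apply]
    by_cases hij : i ≤ j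
    · rw [toeplitz_apply_le _ hij, toeplitz_apply_le _ hij, Matrix.one_apply]
      have : i = j ↔ (j : ℕ) - i = 0 := by
        rw [Fin.ext_iff]
        have : (i : ℕ) ≤ j := hij
        omega
      simp only [this]
    · rw [toeplitz_apply_not_le _ hij, toeplitz_apply_not_le _ hij, Matrix.one_apply_ne, sub_zero]
      rintro rfl
      exact hij le_rfl
  have hentry : ∀ i j, (fun x => (1 - matrixLaplace P' (fun ω' => (H x ω' : ℝ≥0∞))
      (jordanBlock n z)) i j) =ᵐ[Λ] fun x => toeplitz n (fun k => ∫ h, F k h ∂κ x) i j :=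
    fun i j => by
      filter_upwards [hae] with x hx
      rw [hx.2]
  have hI1 := matrixLaplace_jordanBlock (P := P) hI (n := n) (z := z)
    ((hL.ae_ne_top hI hν).mono fun ω h h' => absurd h' h) hintI
  refine ⟨hI1.1, hae.mono fun x hx => hx.1, fun i j => ?_, ?_⟩
  · rw [integrable_congr (hentry i j)]
    by_cases hij : i ≤ j
    · simp only [toeplitz_apply_le _ hij]
      exact integrable_integral_of_integrable_bind (hFint _ (by omega))
    · simp only [toeplitz_apply_not_le _ hij]
      exact integrable_zero _ _ _
  · have hmat : -(Matrix.of fun i j => ∫ x, (1 - matrixLaplace P' (fun ω' => (H x ω' : ℝ≥0∞))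
        (jordanBlock n z)) i j ∂Λ) = toeplitz n (fun k => -∫ h, F k h ∂(Λ.bind κ)) := by
      ext i j
      rw [Matrix.neg_apply, Matrix.of_apply, integral_congr_ae (hentry i j)]
      by_cases hij : i ≤ j
      · simp only [toeplitz_apply_le _ hij]
        rw [integral_bind_eq (hFint _ (by omega))]
      · simp only [toeplitz_apply_not_le _ hij, integral_zero, neg_zero]
    rw [hmat, hI1.2]
    -- The exponent has coefficients -ψ^(k)(z)/k!, so what remains is the value at order 0 and the
    -- recursion.
    refine (exp_toeplitz ?_ fun k hk => ?_).symm
    · rw [hL.expMoment_zero_of_re_nonneg hI hν hz, hF0]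
      simp
    · have hfs : ∀ j : ℕ, -∫ h, F (j + 1) h ∂(Λ.bind κ) =
          expMoment (Λ.bind κ) (fun h : ℝ≥0 => (h : ℝ)) (j + 1) z / (j + 1).factorial := by
        intro j
        rw [hFs, integral_neg, neg_neg, integral_div, expMoment]
      simp only [hfs]
      exact toeplitz_recursion (A := fun k =>
        expMoment (P.restrict {ω | I ω ≠ ∞}) (fun ω => (I ω).toReal) k z)
        (B := fun k => expMoment (Λ.bind κ) (fun h : ℝ≥0 => (h : ℝ)) k z) (hrec k hk)

lemma campbellFormula_of_re_pos [IsProbabilityMeasure P] [IsProbabilityMeasure P']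
    [IsMarkovKernel κ] (hH : ∀ x, Measurable (H x)) (hκ : ∀ᵐ x ∂Λ, P'.map (H x) = κ x)
    (hI : Measurable I) (hL : HasLevyLaplace P I (Λ.bind κ))
    (hν : Integrable (fun h : ℝ≥0 => min 1 (h : ℝ)) (Λ.bind κ)) (n : ℕ) {z : ℂ} (hz : 0 < z.re) :
    CampbellFormula P I P' H Λ (jordanBlock n z) :=
  campbellFormula_of_recursion hH hκ hI hL hν hz.le
    (fun k _ => integrable_expMoment (mem_interior_integrableExpSet_neg hI.ennreal_toReal
      (fun _ => ENNReal.toReal_nonneg) hz) k)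
    (fun k _ => integrable_expMoment_succ hν k hz)
    (fun k _ => hL.expMoment_succ hI hν k hz)

/-- For 1 ≤ j ≤ n - 1 one has h^j ≤ min(1, h) + h^(n-1), so the two integrability conditions control
all intermediate moments. -/
lemma campbellFormula_of_re_nonneg [IsProbabilityMeasure P] [IsProbabilityMeasure P']
    [IsMarkovKernel κ] (hH : ∀ x, Measurable (H x)) (hκ : ∀ᵐ x ∂Λ, P'.map (H x) = κ x)
    (hI : Measurable I) (hL : HasLevyLaplace P I (Λ.bind κ))
    (hν : Integrable (fun h : ℝ≥0 => min 1 (h : ℝ)) (Λ.bind κ)) {n : ℕ}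
    (hmom : Integrable (fun h : ℝ≥0 => (h : ℝ) ^ (n - 1)) (Λ.bind κ)) {z : ℂ} (hz : 0 ≤ z.re) :
    CampbellFormula P I P' H Λ (jordanBlock n z) := by
  have hmom' : ∀ j, 1 ≤ j → j ≤ n - 1 → Integrable (fun h : ℝ≥0 => (h : ℝ) ^ j) (Λ.bind κ) := by
    intro j hj hjn
    refine (hν.add hmom).mono' (by fun_prop) (Eventually.of_forall fun h => ?_)
    have h0 := h.coe_nonneg
    rw [Real.norm_of_nonneg (by positivity), Pi.add_apply]
    rcases le_total 1 (h : ℝ) with h1 | h1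
    · have := pow_le_pow_right₀ h1 hjn
      rw [min_eq_left h1]
      linarith
    · have := pow_le_pow_of_le_one h0 h1 hj
      rw [min_eq_right h1]
      have h2 : 0 ≤ (h : ℝ) ^ (n - 1) := by positivity
      linarith
  exact campbellFormula_of_recursion hH hκ hI hL hν hz
    (fun k hk => integrable_pow_mul_cexp hI.ennreal_toReal (fun _ => ENNReal.toReal_nonneg)
      (hL.integrable_pow hI hν hmom' (by omega)) hz)
    (fun k hk => integrable_pow_mul_cexp (Y := fun h : ℝ≥0 => (h : ℝ)) (by fun_prop)
      (fun h => h.coe_nonneg) (hmom' (k + 1) (by omega) (by omega)) hz)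
    (fun k hk => hL.expMoment_succ_of_re_nonneg hI hν hmom' (by omega) hz)

lemma integrable_pow_bind_iff (hH : ∀ x, Measurable (H x))
    (hκ : ∀ᵐ x ∂Λ, P'.map (H x) = κ x) (k : ℕ) :
    Integrable (fun h : ℝ≥0 => (h : ℝ) ^ k) (Λ.bind κ) ↔
      ∫⁻ x, ∫⁻ ω', (H x ω' : ℝ≥0∞) ^ k ∂P' ∂Λ < ∞ := by
  have hm : Measurable fun h : ℝ≥0 => (h : ℝ≥0∞) ^ k := by fun_prop
  have h1 : ∫⁻ x, ∫⁻ ω', (H x ω' : ℝ≥0∞) ^ k ∂P' ∂Λ = ∫⁻ h : ℝ≥0, (h : ℝ≥0∞) ^ k ∂(Λ.bind κ) := by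
    rw [Measure.lintegral_bind κ.measurable.aemeasurable hm.aemeasurable]
    refine lintegral_congr_ae ?_
    filter_upwards [hκ] with x hx
    rw [← hx, lintegral_map hm (hH x)]
  have h2 : ∀ h : ℝ≥0, ENNReal.ofReal ((h : ℝ) ^ k) = (h : ℝ≥0∞) ^ k := fun h => by
    rw [ENNReal.ofReal_pow h.coe_nonneg, ENNReal.ofReal_coe_nnreal]
  rw [h1, Integrable, hasFiniteIntegral_iff_ofReal
    (Eventually.of_forall fun h => pow_nonneg h.coe_nonneg k)]
  simp only [h2, and_iff_right_iff_imp]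
  intro _
  fun_prop

/-- If the matrix Laplace transform at a nilpotent Jordan block of size `n ≥ 2` exists, then the
random variable is almost surely finite. -/
lemma ae_ne_top_of_matrixLaplaceExists {n : ℕ} (hn : 2 ≤ n)
    (h : MatrixLaplaceExists P I (jordanBlock n 0)) : ∀ᵐ ω ∂P, I ω ≠ ∞ := by
  filter_upwards [h.1] with ω hω htop
  obtain ⟨L, hlim⟩ := hω htop
  simp only [exp_neg_smul_jordanBlock] at hlim
  -- Entry (0, 1) of exp(-rJ) is -r, which has no finite limit.
  have h1 := tendsto_pi_nhds.1 (tendsto_pi_nhds.1 hlim ⟨0, by omega⟩) ⟨1, by omega⟩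
  simp only [toeplitz_apply_le _ (show (⟨0, by omega⟩ : Fin n) ≤ ⟨1, by omega⟩ by simp)] at h1
  have h2 := (Complex.continuous_re.tendsto _).comp h1.neg
  refine not_tendsto_nhds_of_tendsto_atTop tendsto_id _ (h2.congr fun r => ?_)
  simp

/-- If the matrix Laplace transform at a nilpotent Jordan block of size `n` exists, then the
random variable has a finite moment of order `n - 1`. -/
lemma integrable_pow_of_matrixLaplaceExists (hI : Measurable I) {n : ℕ} (hn : 1 ≤ n)
    (h : MatrixLaplaceExists P I (jordanBlock n 0)) :
    Integrable (fun ω => (I ω).toReal ^ (n - 1)) (P.restrict {ω | I ω ≠ ∞}) := by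
  have hS : MeasurableSet {ω | I ω ≠ ∞} := hI (measurableSet_singleton ∞).compl
  -- The corner entry is (-I)^(n-1)/(n-1)!.
  have h1 := ((h.2 ⟨0, by omega⟩ ⟨n - 1, by omega⟩).norm.const_mul
    ((n - 1).factorial : ℝ)).restrict (s := {ω | I ω ≠ ∞})
  refine h1.congr ((ae_restrict_iff' hS).2 (Eventually.of_forall fun ω hω => ?_))
  have hfac : ((n - 1).factorial : ℝ) ≠ 0 := by exact_mod_cast (n - 1).factorial_ne_zero
  simp only
  rw [expNegMul_jordanBlock 0 hω, toeplitz_apply_le _ (by simp [Fin.le_def]), norm_div]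
  simp only [Nat.sub_zero, norm_pow_mul_cexp _ _ (ENNReal.toReal_nonneg (a := I ω))]
  simp
  field_simp

end Campbell

/-- A family of probability measures that depends almost everywhere measurably on a parameter
agrees almost everywhere with a Markov kernel. -/
lemma exists_isMarkovKernel_ae_eq {β γ : Type*} [MeasurableSpace β] [MeasurableSpace γ] [Nonempty γ]
    {Λ : Measure β} {law : β → Measure γ} (hlaw : AEMeasurable law Λ)
    (hp : ∀ x, IsProbabilityMeasure (law x)) :
    ∃ κ : Kernel β γ, IsMarkovKernel κ ∧ ∀ᵐ x ∂Λ, law x = κ x := by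
  -- The measurable version must consist of probability measures off the null set too; the Dirac
  -- mass shows that there is one to choose.
  obtain ⟨g, hg, hgr, hae⟩ := hlaw.exists_ae_eq_range_subset
    (t := {μ | IsProbabilityMeasure μ}) (Eventually.of_forall hp)
    ⟨Measure.dirac (Classical.arbitrary γ), Measure.dirac.isProbabilityMeasure⟩
  exact ⟨⟨g, hg⟩, ⟨fun x => hgr ⟨x, rfl⟩⟩, hae⟩

end ShotNoise

/-! ### The three cases of the theorem -/

theorem mainTheorem1 {d : ℕ}
    {Ω : Type*} [MeasurableSpace Ω] (P : Measure Ω) [IsProbabilityMeasure P]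
    {Ω' : Type*} [MeasurableSpace Ω'] (P' : Measure Ω') [IsProbabilityMeasure P']
    (Λ : Measure (EuclideanSpace ℝ (Fin d))) [IsLocallyFiniteMeasure Λ]
    (H : EuclideanSpace ℝ (Fin d) → Ω' → ℝ≥0)
    (hH : ∀ x, Measurable (H x))
    (hlaw : AEMeasurable (fun x => P'.map (H x)) Λ)
    (Φ : Ω → Measure (EuclideanSpace ℝ (Fin d)))
    (hΦ : ShotNoise.IsPoissonPointProcess P Φ Λ)
    (N : Ω → ℕ∞) (X : ℕ → Ω → EuclideanSpace ℝ (Fin d))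
    (hX : ShotNoise.IsEnumeration P Φ N X)
    (M : ℕ → Ω → ℝ≥0)
    (hM : ShotNoise.IsIndependentMarking P N X M (fun x => P'.map (H x)))
    (n : ℕ) (hn : 1 ≤ n) :
    -- eigenvalue in the open right half-plane
    (∀ lam : ℂ, 0 < lam.re →
      (Integrable (fun x => 1 - ShotNoise.scalarLaplace P' (H x) lam) Λ →
        ShotNoise.CampbellFormula P (ShotNoise.shotNoise N M) P' H Λ
          (ShotNoise.jordanBlock n lam)) ∧
      (¬ Integrable (fun x => 1 - ShotNoise.scalarLaplace P' (H x) lam) Λ →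
        ShotNoise.MatrixLaplaceExists P (ShotNoise.shotNoise N M) (ShotNoise.jordanBlock n lam) ∧
        ShotNoise.matrixLaplace P (ShotNoise.shotNoise N M) (ShotNoise.jordanBlock n lam) = 0)) ∧
    -- eigenvalue zero
    (2 ≤ n →
      (((∫⁻ x, ∫⁻ ω', (H x ω' : ℝ≥0∞) ^ (n - 1) ∂P' ∂Λ < ∞) ∧
          (3 ≤ n → ∀ s : ℝ, 0 ≤ s →
            Integrable (fun x => 1 - ShotNoise.scalarLaplace P' (H x) (s : ℂ)) Λ)) →
        ShotNoise.CampbellFormula P (ShotNoise.shotNoise N M) P' H Λ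
          (ShotNoise.jordanBlock n 0)) ∧
      (¬ ((∫⁻ x, ∫⁻ ω', (H x ω' : ℝ≥0∞) ^ (n - 1) ∂P' ∂Λ < ∞) ∧
          (3 ≤ n → ∀ s : ℝ, 0 ≤ s →
            Integrable (fun x => 1 - ShotNoise.scalarLaplace P' (H x) (s : ℂ)) Λ)) →
        ¬ ShotNoise.MatrixLaplaceExists P (ShotNoise.shotNoise N M)
          (ShotNoise.jordanBlock n 0))) ∧
    -- eigenvalue on the imaginary axis
    (∀ lam : ℂ, lam.re = 0 →
      (∀ s : ℝ, 0 ≤ s →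
        Integrable (fun x => 1 - ShotNoise.scalarLaplace P' (H x) (s : ℂ)) Λ) →
      (∫⁻ x, ∫⁻ ω', (H x ω' : ℝ≥0∞) ^ (n - 1) ∂P' ∂Λ < ∞) →
      ShotNoise.CampbellFormula P (ShotNoise.shotNoise N M) P' H Λ
        (ShotNoise.jordanBlock n lam)) := by
  obtain ⟨κ, hκm, hκ⟩ := ShotNoise.exists_isMarkovKernel_ae_eq hlaw
    fun x => Measure.isProbabilityMeasure_map (hH x).aemeasurable
  have hMκ := hM.congr_law hX hΦ hκ
  set I := ShotNoise.shotNoise N M with hIdef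
  have hI : Measurable I := ShotNoise.measurable_shotNoise hX.measurable_card hM.measurable_mark
  have hL : ShotNoise.HasLevyLaplace P I (Λ.bind κ) :=
    fun s => ShotNoise.lintegral_expNeg_shotNoise hΦ hX hMκ s
  have hcrit : ∀ {z : ℂ}, 0 < z.re →
      Integrable (fun x => 1 - ShotNoise.scalarLaplace P' (H x) z) Λ →
      Integrable (fun h : ℝ≥0 => min 1 (h : ℝ)) (Λ.bind κ) := fun hz =>
    ShotNoise.integrable_min_one_of_integrable_one_sub_scalarLaplace hH hκ hz
  refine ⟨fun lam hlam => ⟨fun hint => ?_, fun hint => ?_⟩,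
    fun hn2 => ⟨fun hcond => ?_, fun hcond hex => hcond ?_⟩, fun lam hlam hint hmom => ?_⟩
  · exact ShotNoise.campbellFormula_of_re_pos hH hκ hI hL (hcrit hlam hint) n hlam
  · have htop := hL.ae_eq_top hI fun hν =>
      hint (ShotNoise.integrable_one_sub_scalarLaplace hH hκ hν hlam.le)
    have hres : P.restrict {ω | I ω ≠ ∞} = 0 := Measure.restrict_eq_zero.2 (by
      simpa [ae_iff] using htop)
    have h := ShotNoise.matrixLaplace_jordanBlock (P := P) hI (n := n) (z := lam)
      (Eventually.of_forall fun ω _ => ShotNoise.tendsto_exp_neg_smul_jordanBlock hlam)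
      (fun k _ => by rw [hres]; exact integrable_zero_measure)
    refine ⟨h.1, ?_⟩
    rw [h.2, hres]
    ext i j
    simp [ShotNoise.toeplitz, ShotNoise.expMoment]
  · have hmom := (ShotNoise.integrable_pow_bind_iff hH hκ (n - 1)).2 hcond.1
    have hν : Integrable (fun h : ℝ≥0 => min 1 (h : ℝ)) (Λ.bind κ) := by
      -- For n = 2 the moment condition has order 1 and suffices alone, as min(1, h) ≤ h.
      rcases Nat.lt_or_ge 2 n with h3 | h3
      · exact hcrit (z := ((1 : ℝ) : ℂ)) (by simp) (hcond.2 h3 1 zero_le_one)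
      · obtain rfl : n = 2 := le_antisymm h3 hn2
        refine hmom.mono' (by fun_prop) (Eventually.of_forall fun h => ?_)
        rw [Real.norm_of_nonneg (le_min zero_le_one h.coe_nonneg)]
        simp
    exact ShotNoise.campbellFormula_of_re_nonneg hH hκ hI hL hν hmom le_rfl
  · have hfin := ShotNoise.ae_ne_top_of_matrixLaplaceExists hn2 hex
    have hν : Integrable (fun h : ℝ≥0 => min 1 (h : ℝ)) (Λ.bind κ) := by
      by_contra hν
      obtain ⟨ω, h1, h2⟩ := (hfin.and (hL.ae_eq_top hI hν)).exists
      exact h1 h2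
    refine ⟨(ShotNoise.integrable_pow_bind_iff hH hκ (n - 1)).1 ?_, fun _ s hs =>
      ShotNoise.integrable_one_sub_scalarLaplace hH hκ hν (by simpa using hs)⟩
    have hmom := ShotNoise.integrable_pow_of_matrixLaplaceExists hI hn hex
    -- The order n - 1 = k + 1 is positive, as the passage from moments of I to moments of ν
    -- requires.
    obtain ⟨k, rfl⟩ : ∃ k, n = k + 2 := ⟨n - 2, by omega⟩
    exact hL.integrable_pow_levy hI hν hmom
  · have hν := hcrit (z := ((1 : ℝ) : ℂ)) (by simp) (hint 1 zero_le_one)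
    exact ShotNoise.campbellFormula_of_re_nonneg hH hκ hI hL hν
      ((ShotNoise.integrable_pow_bind_iff hH hκ (n - 1)).2 hmom) hlam.ge
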